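/- **Theorem (expected running time of Beneath-Beyond).** Let $n\ge 2$ be fixed and let $a_1,\dots,a_m$ be independent uniformly distributed random points on the unit sphere $S^{n-1}\subset\mathbb R^n$. Let $T(a_1,\dots,a_m)$ be the number of elementary steps (unit-cost real arithmetic operations, comparisons, integer operations on labels, memory accesses) performed by the Beneath-Beyond algorithm on input $a_1,\dots,a_m$. Then there are constants $C$ and $k$, depending only on $n$, such that for all $m\ge 2$ $$\mathbb E\,[\,T(a_1,\dots,a_m)\,]\;\le\; C\,m^2(\log m)^k ,$$ that is, the expected running time is $\tilde O(m^2)$. Here the Beneath-Beyond algorithm is the following incremental convex hull algorithm. Write $P_t=\operatorname{conv}(0,a_1,\dots,a_t)$, which is almost surely a simplicial polytope for $t\ge n$. If $m<n$ it returns no facets. Otherwise it computes the facets of the simplex $P_n$, each facet being stored as its list of $n$ labelled vertices together with a linear inequality. For $t=n,\dots,m-1$ it obtains the facets of $P_{t+1}$ from those of $P_t$ thus: it tests each stored inequality at $a_{t+1}$; it keeps the facets whose inequality holds at $a_{t+1}$ and removes the others; it lists the $(n-2)$-dimensional faces of the removed facets, sorts this list (merge sort by vertex labels), and selects those that occur in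 exactly one removed facet; for each of these it adds the facet spanned by it and $a_{t+1}$, computing the new inequality from determinants of the $n$ vertices and orienting it so that the removed vertex satisfies it. -/

import Mathlib

open MeasureTheory
open scoped ENNReal

/-! ## Step counting

A computation is its result together with the number of elementary steps it used (unit-cost real
RAM): `prim` performs one elementary operation (a field operation, a comparison, an integer
operation on vertex labels, reading or writing one memory cell), and `charge c` accounts for `c`
elementary operations that have no result of their own (copying an array). -/

structure Timed (α : Type) where
  val : α
  cost : ℕ

namespace Timed

def bind {α β : Type} (x : Timed α) (f : α → Timed β) : Timed β :=
  ⟨(f x.val).val, x.cost + (f x.val).cost⟩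

instance : Monad Timed where
  pure a := ⟨a, 0⟩
  bind := Timed.bind

def prim {α : Type} (a : α) : Timed α := ⟨a, 1⟩

def charge (c : ℕ) : Timed Unit := ⟨(), c⟩

end Timed

namespace BeneathBeyond

open Timed

/-! ### List and array operations -/

def mapT {α β : Type} (f : α → Timed β) : List α → Timed (List β)
  | [] => prim []
  | x :: xs => do
    let y ← f x
    let ys ← mapT f xs
    prim (y :: ys)

def appendT {α : Type} : List α → List α → Timed (List α)
  | [], ys => prim ys
  | x :: xs, ys => do
    let zs ← appendT xs ys
    prim (x :: zs)

def flatMapT {α β : Type} (f : α → Timed (List β)) : List α → Timed (List β)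
  | [] => prim []
  | x :: xs => do
    let ys ← f x
    let zs ← flatMapT f xs
    appendT ys zs

/-- Splits a list into the entries that pass the test and those that do not. -/
def partitionT {α : Type} (test : α → Timed Bool) : List α → Timed (List α × List α)
  | [] => prim ([], [])
  | x :: xs => do
    let b ← test x
    let r ← partitionT test xs
    if b then prim (x :: r.1, r.2) else prim (r.1, x :: r.2)

/-- Deals the entries of a list alternately into two lists. -/
def splitT {α : Type} : List α → Timed (List α × List α)
  | [] => prim ([], [])
  | x :: xs => do
    let r ← splitT xs
    prim (x :: r.2, r.1)

def mergeT {α : Type} (le : α → α → Timed Bool) : List α → List α → Timed (List α)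
  | [], ys => prim ys
  | x :: xs, [] => prim (x :: xs)
  | x :: xs, y :: ys => do
    let b ← le x y
    if b then do
      let zs ← mergeT le xs (y :: ys)
      prim (x :: zs)
    else do
      let zs ← mergeT le (x :: xs) ys
      prim (y :: zs)
termination_by xs ys => xs.length + ys.length

/-- Merge sort; the first argument only bounds the depth of the recursion. -/
def mergeSortT {α : Type} (le : α → α → Timed Bool) : ℕ → List α → Timed (List α)
  | 0, xs => prim xs
  | _ + 1, [] => prim []
  | _ + 1, [x] => prim [x]
  | d + 1, x :: y :: xs => do
    let r ← splitT (x :: y :: xs)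
    let us ← mergeSortT le d r.1
    let vs ← mergeSortT le d r.2
    mergeT le us vs

def lengthT {α : Type} : List α → Timed ℕ
  | [] => prim 0
  | _ :: xs => do
    let l ← lengthT xs
    prim (l + 1)

def sortT {α : Type} (le : α → α → Timed Bool) (xs : List α) : Timed (List α) := do
  let l ← lengthT xs
  mergeSortT le l xs

def arrayT {α : Type} : (k : ℕ) → (Fin k → Timed α) → Timed (Fin k → α)
  | 0, _ => prim Fin.elim0
  | k + 1, f => do
    let x ← f 0
    let g ← arrayT k (fun i => f i.succ)
    prim (Matrix.vecCons x g)

section Arithmetic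

variable {K : Type} [CommRing K]

def sumT : (k : ℕ) → (Fin k → Timed K) → Timed K
  | 0, _ => prim 0
  | k + 1, f => do
    let x ← f 0
    let s ← sumT k (fun i => f i.succ)
    prim (x + s)

/-- `(-1) ^ j * x`. -/
def signedT (j : ℕ) (x : K) : Timed K :=
  if j % 2 = 0 then prim x else prim (-x)

/-- The determinant, by Laplace expansion along the first row. -/
def detT : (k : ℕ) → Matrix (Fin k) (Fin k) K → Timed K
  | 0, _ => prim 1
  | k + 1, A => sumT (k + 1) fun j => do
    charge (k * k)
    let d ← detT k (A.submatrix Fin.succ j.succAbove)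
    let x ← prim (A 0 j)
    let y ← prim (x * d)
    signedT j y

end Arithmetic

/-! ### Vertices, facets and ridges of simplicial polytopes in dimension `n` -/

/-- A point together with its label (its position in the input; the origin has label `0`). -/
structure Vertex (n : ℕ) (K : Type) where
  idx : ℕ
  pt : Fin n → K

/-- A simplicial facet: its `n` vertices, by decreasing label, and the coefficients of a
valid inequality `coef 0 + ∑ i, coef (i + 1) * x i ≤ 0` that is tight on these vertices. -/
structure Facet (n : ℕ) (K : Type) where
  verts : List (Vertex n K)
  coef : Fin (n + 1) → K

/-- A simplex with one vertex `opp` removed; `verts` are the others, by decreasing label. -/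
structure Ridge (n : ℕ) (K : Type) where
  verts : List (Vertex n K)
  opp : Vertex n K

section Algorithm

variable {n : ℕ} {K : Type}

/-- All the ways of removing one vertex. -/
def ridgesT : List (Vertex n K) → Timed (List (Ridge n K))
  | [] => prim []
  | v :: vs => do
    let rs ← ridgesT vs
    let rs' ← mapT (fun r : Ridge n K => prim ⟨v :: r.verts, r.opp⟩) rs
    prim (⟨vs, v⟩ :: rs')

/-- Lexicographic comparison of the lists of labels. -/
def lexLeT : List (Vertex n K) → List (Vertex n K) → Timed Bool
  | [], _ => prim true
  | _ :: _, [] => prim false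
  | u :: us, v :: vs => do
    let b ← prim (decide (u.idx < v.idx))
    if b then prim true
    else do
      let b' ← prim (decide (v.idx < u.idx))
      if b' then prim false else lexLeT us vs

def ridgeLeT (r s : Ridge n K) : Timed Bool := lexLeT r.verts s.verts

/-- Whether two ridges have the same vertices. -/
def ridgeEqT (r s : Ridge n K) : Timed Bool := do
  let b ← ridgeLeT r s
  if b then ridgeLeT s r else prim false

/-- From a sorted list of ridges, cancels the ridges that occur twice. -/
def cancelPairsT : List (Ridge n K) → Timed (List (Ridge n K))
  | [] => prim []
  | [r] => prim [r]
  | r :: s :: rs => do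
    let b ← ridgeEqT r s
    if b then cancelPairsT rs
    else do
      let ts ← cancelPairsT (s :: rs)
      prim (r :: ts)

variable [CommRing K]

/-- The value at `x` of the affine function `coef 0 + ∑ i, coef (i + 1) * x i`. -/
def evalT (coef : Fin (n + 1) → K) (x : Fin n → K) : Timed K :=
  sumT (n + 1) fun j => do
    let c ← prim (coef j)
    let y ← prim (Matrix.vecCons 1 x j : K)
    prim (c * y)

variable [LinearOrder K]

/-- Whether `x` lies beyond a facet, that is, violates its inequality. -/
def beyondT (x : Fin n → K) (F : Facet n K) : Timed Bool := do
  let h ← evalT F.coef x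
  prim (decide (0 < h))

/-- The facet with vertices `vs`, with its inequality oriented so that `opp` satisfies it. The
affine function `x ↦ det ((1, x), (1, v₁), …, (1, vₙ))`, which vanishes on the hyperplane through
`v₁, …, vₙ`, is found by computing its cofactors, and negated if it is positive at `opp`. -/
def mkFacetT (vs : List (Vertex n K)) (opp : Vertex n K) : Timed (Facet n K) := do
  charge (n * (n + 1))
  let M : Matrix (Fin n) (Fin (n + 1)) K :=
    fun i => Matrix.vecCons 1 (vs.getD i ⟨0, 0⟩).pt
  let c ← arrayT (n + 1) fun j => do
    charge (n * n)
    let d ← detT n (M.submatrix id j.succAbove)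
    signedT j d
  let h ← evalT c opp.pt
  let b ← prim (decide (0 < h))
  if b then do
    let c' ← arrayT (n + 1) fun j => prim (-(c j))
    prim ⟨vs, c'⟩
  else prim ⟨vs, c⟩

/-- The facets of a simplex given by its `n + 1` vertices. -/
def simplexT (vs : List (Vertex n K)) : Timed (List (Facet n K)) := do
  let rs ← ridgesT vs
  mapT (fun r => mkFacetT r.verts r.opp) rs

/-- One incremental step. The facets that `p` is not beyond are kept and the others are removed.
A ridge of a removed facet is coned with `p` if it is on the horizon, that is, if it lies in only
one removed facet; the horizon is found by sorting the ridges of all removed facets. -/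
def stepT (Fs : List (Facet n K)) (p : Vertex n K) : Timed (List (Facet n K)) := do
  let r ← partitionT (beyondT p.pt) Fs
  let rs ← flatMapT (fun F : Facet n K => ridgesT F.verts) r.1
  let sorted ← sortT ridgeLeT rs
  let horizon ← cancelPairsT sorted
  let new ← mapT (fun r => mkFacetT (p :: r.verts) r.opp) horizon
  appendT new r.2

/-- Adds the remaining points one after the other; `t` is the label of the next one. -/
def insertAllT : List (Facet n K) → ℕ → List (Fin n → K) → Timed (List (Facet n K))
  | Fs, _, [] => prim Fs
  | Fs, t, p :: ps => do
    let Fs' ← stepT Fs ⟨t, p⟩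
    let t' ← prim (t + 1)
    insertAllT Fs' t' ps

/-- Collects `d` more vertices of the initial simplex, computes its facets, and then adds the
remaining points. If the points run out there is no full-dimensional polytope and no facet. -/
def startT : (d : ℕ) → ℕ → List (Vertex n K) → List (Fin n → K) → Timed (List (Facet n K))
  | 0, t, vs, ps => do
    let Fs ← simplexT vs
    insertAllT Fs t ps
  | _ + 1, _, _, [] => prim []
  | d + 1, t, vs, p :: ps => do
    let vs' ← prim (⟨t, p⟩ :: vs)
    let t' ← prim (t + 1)
    startT d t' vs' ps

/-- The Beneath-Beyond algorithm: from points `a₁, …, aₘ` in dimension `n` (in general position)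
it computes the facets of the convex hull `Pₘ` of `0, a₁, …, aₘ`, starting from the simplex `Pₙ`
and passing through the polytopes `Pₜ`, the convex hulls of `0, a₁, …, aₜ`. -/
def beneathBeyond (ps : List (Fin n → K)) : Timed (List (Facet n K)) :=
  startT n 1 [⟨0, 0⟩] ps

end Algorithm

/-! ### The random model -/

/-- The uniform probability measure on the unit sphere of `ℝⁿ`. -/
noncomputable def sphereUniform (n : ℕ) :
    Measure (Metric.sphere (0 : EuclideanSpace ℝ (Fin n)) 1) :=
  ((volume : Measure (EuclideanSpace ℝ (Fin n))).toSphere Set.univ)⁻¹ •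
    (volume : Measure (EuclideanSpace ℝ (Fin n))).toSphere

/-- `m` independent uniform points on the unit sphere of `ℝⁿ`. -/
noncomputable def randomPoints (n m : ℕ) :
    Measure (Fin m → Metric.sphere (0 : EuclideanSpace ℝ (Fin n)) 1) :=
  Measure.pi fun _ => sphereUniform n

/-- The number of steps of the Beneath-Beyond algorithm on the points `a 0, …, a (m - 1)`. -/
noncomputable def runningTime {n m : ℕ}
    (a : Fin m → Metric.sphere (0 : EuclideanSpace ℝ (Fin n)) 1) : ℕ :=
  (beneathBeyond (List.ofFn fun i => (fun j => (a i : EuclideanSpace ℝ (Fin n)) j))).cost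

end BeneathBeyond

/-! For fixed n, one insertion step costs a constant per current facet, except that sorting the
ridges adds a factor logarithmic in m. Up to such factors the running time is therefore the sum over
t of the number of facets stored at time t. Two facts are needed: the stored lists contain only
genuine, distinct facets, and the expected number of facets is O(m (log m)^n).

Correctness. Almost surely no n + 1 of the points 0, a_1, ..., a_m lie on a hyperplane
(`ae_generalPosition`, by Fubini from the nullity of hyperplane sections of the sphere). Then
`Invariant` persists: each stored facet is spanned by n of the points and valid for all points so
far, no label list is repeated, and each ridge occurs an even number of times, so that the list is a
cycle modulo two. That the list contains all facets is never needed. A ridge that survives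
cancellation lies in an odd number of removed facets, hence by parity in some kept facet G. A
nonnegative combination of the inequality of G and of that of a removed facet through the ridge is
valid and vanishes at the new point; by general position the computed facet is the same one
(`isFacet_cone`, `isFacet_mkFacetT`). The cycle property persists because the boundary of a boundary
vanishes.

Counting. Choose ρ with ρ^(n-1) of order (log m)/t, and a net of about ρ^(-(n-1)) caps of radius ρ.
With probability 1 - O(m^(-n)) each of them contains an earlier point. The open cap that a facet
cuts off contains no point, so its radius is below 2ρ, and all vertices of the facet lie in one ball
of radius 3ρ about a point of the net (`IsFacet.exists_cap`). The expected number of n-sets of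
points in such balls is of order ρ^(-(n-1)) (t ρ^(n-1))^n, that is t (log m)^(n-1). In the
exceptional event, and for t of order log m, the trivial bound t^n suffices
(`exists_expected_length_le`). Summation over t gives the theorem. -/

namespace BeneathBeyond

open Timed

/-! ### Results and costs of the elementary list and arithmetic routines. -/

section TimedLemmas

variable {α β : Type}

@[simp] theorem val_bind (x : Timed α) (f : α → Timed β) : (x >>= f).val = (f x.val).val := rfl
@[simp] theorem cost_bind (x : Timed α) (f : α → Timed β) :
    (x >>= f).cost = x.cost + (f x.val).cost := rfl
@[simp] theorem val_prim (a : α) : (prim a).val = a := rfl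
@[simp] theorem cost_prim (a : α) : (prim a).cost = 1 := rfl
@[simp] theorem cost_charge (c : ℕ) : (charge c).cost = c := rfl

theorem mapT_val (f : α → Timed β) (l : List α) : (mapT f l).val = l.map fun x => (f x).val := by
  induction l with
  | nil => rfl
  | cons x xs ih => simp [mapT, ih]

theorem mapT_cost_le (f : α → Timed β) {l : List α} {c : ℕ} (h : ∀ x ∈ l, (f x).cost ≤ c) :
    (mapT f l).cost ≤ (c + 1) * l.length + 1 := by
  induction l with
  | nil => simp [mapT]
  | cons x xs ih =>
    have h1 := ih fun y hy => h y (List.mem_cons_of_mem _ hy)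
    have h2 := h x List.mem_cons_self
    simp only [mapT, cost_bind, cost_prim, List.length_cons]
    linarith

theorem appendT_val (xs ys : List α) : (appendT xs ys).val = xs ++ ys := by
  induction xs with
  | nil => rfl
  | cons x xs ih => simp [appendT, ih]

theorem appendT_cost (xs ys : List α) : (appendT xs ys).cost = xs.length + 1 := by
  induction xs with
  | nil => rfl
  | cons x xs ih => simp [appendT, ih]

theorem flatMapT_val (f : α → Timed (List β)) (l : List α) :
    (flatMapT f l).val = l.flatMap fun x => (f x).val := by
  induction l with
  | nil => rfl
  | cons x xs ih => simp [flatMapT, ih, appendT_val]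

theorem flatMapT_cost_le (f : α → Timed (List β)) {l : List α} {c k : ℕ}
    (h : ∀ x ∈ l, (f x).cost ≤ c) (hk : ∀ x ∈ l, (f x).val.length ≤ k) :
    (flatMapT f l).cost ≤ (c + k + 1) * l.length + 1 := by
  induction l with
  | nil => simp [flatMapT]
  | cons x xs ih =>
    have h1 := ih (fun y hy => h y (List.mem_cons_of_mem _ hy))
      (fun y hy => hk y (List.mem_cons_of_mem _ hy))
    have h2 := h x List.mem_cons_self
    have h3 := hk x List.mem_cons_self
    simp only [flatMapT, cost_bind, appendT_cost, List.length_cons]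
    linarith

theorem partitionT_val (test : α → Timed Bool) (l : List α) :
    (partitionT test l).val =
      (l.filter fun x => (test x).val, l.filter fun x => !(test x).val) := by
  induction l with
  | nil => rfl
  | cons x xs ih =>
    cases hx : (test x).val <;> simp [partitionT, hx, ih]

theorem partitionT_cost_le (test : α → Timed Bool) {l : List α} {c : ℕ}
    (h : ∀ x ∈ l, (test x).cost ≤ c) : (partitionT test l).cost ≤ (c + 1) * l.length + 1 := by
  induction l with
  | nil => simp [partitionT]
  | cons x xs ih =>
    have h1 := ih fun y hy => h y (List.mem_cons_of_mem _ hy)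
    have h2 := h x List.mem_cons_self
    cases hx : (test x).val <;>
    · simp only [partitionT, cost_bind, hx, List.length_cons, if_true, cost_prim,
        Bool.false_eq_true, if_false]
      linarith

theorem splitT_cost (l : List α) : (splitT l).cost = l.length + 1 := by
  induction l with
  | nil => rfl
  | cons x xs ih => simp [splitT, ih]

theorem splitT_perm (l : List α) : ((splitT l).val.1 ++ (splitT l).val.2).Perm l := by
  induction l with
  | nil => simp [splitT]
  | cons x xs ih =>
    simp only [splitT, val_bind, val_prim, List.cons_append]
    exact (List.perm_append_comm.trans ih).cons x

theorem splitT_length (l : List α) :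
    (splitT l).val.1.length = (l.length + 1) / 2 ∧ (splitT l).val.2.length = l.length / 2 := by
  induction l with
  | nil => simp [splitT]
  | cons x xs ih =>
    simp only [splitT, val_bind, val_prim, List.length_cons, ih]
    exact ⟨by omega, trivial⟩

theorem mergeT_val (le : α → α → Timed Bool) (xs ys : List α) :
    (mergeT le xs ys).val = List.merge xs ys fun a b => (le a b).val := by
  induction xs, ys using mergeT.induct with
  | case1 ys => simp [mergeT]
  | case2 x xs => simp [mergeT]
  | case3 x xs y ys h1 h2 =>
    cases hx : (le x y).val <;> simp [mergeT, *]

theorem mergeT_cost_le (le : α → α → Timed Bool) {c : ℕ} (xs ys : List α)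
    (h : ∀ x ∈ xs, ∀ y ∈ ys, (le x y).cost ≤ c) :
    (mergeT le xs ys).cost ≤ (c + 1) * (xs.length + ys.length) + 1 := by
  induction xs, ys using mergeT.induct with
  | case1 ys => simp [mergeT]
  | case2 x xs => simp [mergeT]
  | case3 x xs y ys h1 h2 =>
    have h0 := h x (by simp) y (by simp)
    have h1 := h1 fun a ha b hb => h a (by simp [ha]) b hb
    have h2 := h2 fun a ha b hb => h a ha b (by simp [hb])
    simp only [List.length_cons] at h1 h2 ⊢
    cases hx : (le x y).val
    · simp only [mergeT, cost_bind, hx, Bool.false_eq_true, if_false, cost_prim]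
      linarith
    · simp only [mergeT, cost_bind, hx, if_true, cost_prim]
      linarith

theorem mergeSortT_perm (le : α → α → Timed Bool) (d : ℕ) (l : List α) :
    (mergeSortT le d l).val.Perm l := by
  induction d, l using mergeSortT.induct with
  | case1 xs => simp [mergeSortT]
  | case2 d => simp [mergeSortT]
  | case3 d x => simp [mergeSortT]
  | case4 d x y xs h1 h2 =>
    simp only [mergeSortT, val_bind, mergeT_val]
    exact (List.merge_perm_append _).trans (((h1 _).append (h2 _)).trans (splitT_perm _))

/-- At depth 0 the list is returned unsorted, which is harmless for length at most 1. Splitting a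
list of length at least 2 shortens both halves by at least one, so the length is a sufficient depth.
-/
theorem mergeSortT_pairwise (le : α → α → Timed Bool)
    (trans : ∀ a b c, (le a b).val → (le b c).val → (le a c).val)
    (total : ∀ a b, (le a b).val || (le b a).val) (d : ℕ) (l : List α) (hd : l.length ≤ d + 1) :
    (mergeSortT le d l).val.Pairwise fun a b => (le a b).val := by
  induction d generalizing l with
  | zero =>
    match l, hd with
    | [], _ => simp [mergeSortT]
    | [x], _ => simp [mergeSortT]
  | succ d ih =>
    match l, hd with
    | [], _ => simp [mergeSortT]
    | [x], _ => simp [mergeSortT]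
    | x :: y :: xs, hd =>
      simp only [mergeSortT, val_bind, mergeT_val]
      have hl := splitT_length (x :: y :: xs)
      simp only [List.length_cons] at hl hd
      exact List.pairwise_merge trans total _ _ (ih _ (by omega)) (ih _ (by omega))

/-- The depth bound d plays no role for the cost: halving turns the exponent D + 1 into D. One level
costs at most (c + 2) |l| for splitting and merging plus additive constants, and 3 |l| more absorbs
these because |l| ≥ 2. -/
theorem mergeSortT_cost_le (le : α → α → Timed Bool) {c : ℕ} (d D : ℕ) (l : List α)
    (h : ∀ x ∈ l, ∀ y ∈ l, (le x y).cost ≤ c) (hD : l.length ≤ 2 ^ D) :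
    (mergeSortT le d l).cost ≤ (c + 5) * l.length * D + 1 := by
  induction d generalizing l D with
  | zero => simp [mergeSortT]
  | succ d ih =>
    match l, h, hD with
    | [], _, _ => simp [mergeSortT]
    | [x], _, _ => simp [mergeSortT]
    | x :: y :: xs, h, hD =>
      obtain ⟨D, rfl⟩ : ∃ E, D = E + 1 := by
        cases D with
        | zero => simp at hD
        | succ D => exact ⟨D, rfl⟩
      have hp := splitT_perm (x :: y :: xs)
      have hl := splitT_length (x :: y :: xs)
      have hs := splitT_cost (x :: y :: xs)
      have m1 : ∀ a ∈ (splitT (x :: y :: xs)).val.1, a ∈ x :: y :: xs := fun a ha =>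
        hp.subset (List.mem_append_left _ ha)
      have m2 : ∀ a ∈ (splitT (x :: y :: xs)).val.2, a ∈ x :: y :: xs := fun a ha =>
        hp.subset (List.mem_append_right _ ha)
      have hlen : 2 ≤ (x :: y :: xs).length := by simp
      simp only [mergeSortT, cost_bind]
      generalize splitT (x :: y :: xs) = r at *
      generalize x :: y :: xs = l at *
      rw [pow_succ] at hD
      have h1 := ih D r.val.1 (fun a ha b hb => h a (m1 a ha) b (m1 b hb)) (by omega)
      have h2 := ih D r.val.2 (fun a ha b hb => h a (m2 a ha) b (m2 b hb)) (by omega)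
      have h3 := mergeT_cost_le le (mergeSortT le d r.val.1).val (mergeSortT le d r.val.2).val
        (c := c) fun a ha b hb => h a (m1 a ((mergeSortT_perm _ _ _).subset ha)) b
          (m2 b ((mergeSortT_perm _ _ _).subset hb))
      rw [(mergeSortT_perm _ _ _).length_eq, (mergeSortT_perm _ _ _).length_eq] at h3
      have e : r.val.1.length + r.val.2.length = l.length := by omega
      rw [e] at h3
      have e2 : (c + 5) * r.val.1.length * D + (c + 5) * r.val.2.length * D =
          (c + 5) * l.length * D := by rw [← e]; ring
      linarith

theorem lengthT_val (l : List α) : (lengthT l).val = l.length := by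
  induction l with
  | nil => rfl
  | cons x xs ih => simp [lengthT, ih]

theorem lengthT_cost (l : List α) : (lengthT l).cost = l.length + 1 := by
  induction l with
  | nil => rfl
  | cons x xs ih => simp [lengthT, ih]

theorem sortT_perm (le : α → α → Timed Bool) (l : List α) : (sortT le l).val.Perm l :=
  mergeSortT_perm _ _ _

theorem sortT_pairwise (le : α → α → Timed Bool)
    (trans : ∀ a b c, (le a b).val → (le b c).val → (le a c).val)
    (total : ∀ a b, (le a b).val || (le b a).val) (l : List α) :
    (sortT le l).val.Pairwise fun a b => (le a b).val :=
  mergeSortT_pairwise le trans total _ _ (by rw [lengthT_val]; omega)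

theorem sortT_cost_le (le : α → α → Timed Bool) {c : ℕ} (D : ℕ) (l : List α)
    (h : ∀ x ∈ l, ∀ y ∈ l, (le x y).cost ≤ c) (hD : l.length ≤ 2 ^ D) :
    (sortT le l).cost ≤ l.length + 1 + ((c + 5) * l.length * D + 1) := by
  simp only [sortT, cost_bind, lengthT_cost]
  have := mergeSortT_cost_le le (lengthT l).val D l h hD
  linarith

theorem arrayT_val (k : ℕ) (f : Fin k → Timed α) : (arrayT k f).val = fun i => (f i).val := by
  induction k with
  | zero => ext i; exact i.elim0
  | succ k ih =>
    ext i
    simp only [arrayT, val_bind, val_prim, ih]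
    refine Fin.cases ?_ (fun i => ?_) i <;> simp

theorem arrayT_cost_le (k : ℕ) (f : Fin k → Timed α) {c : ℕ} (h : ∀ i, (f i).cost ≤ c) :
    (arrayT k f).cost ≤ (c + 1) * k + 1 := by
  induction k with
  | zero => simp [arrayT]
  | succ k ih =>
    simp only [arrayT, cost_bind, cost_prim]
    have := h 0
    have := ih (fun i => f i.succ) fun i => h i.succ
    linarith

variable {K : Type} [CommRing K]

theorem sumT_val (k : ℕ) (f : Fin k → Timed K) : (sumT k f).val = ∑ i, (f i).val := by
  induction k with
  | zero => rfl
  | succ k ih => simp [sumT, ih, Fin.sum_univ_succ]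

theorem sumT_cost_le (k : ℕ) (f : Fin k → Timed K) {c : ℕ} (h : ∀ i, (f i).cost ≤ c) :
    (sumT k f).cost ≤ (c + 1) * k + 1 := by
  induction k with
  | zero => simp [sumT]
  | succ k ih =>
    simp only [sumT, cost_bind, cost_prim]
    have := h 0
    have := ih (fun i => f i.succ) fun i => h i.succ
    linarith

theorem signedT_val (j : ℕ) (x : K) : (signedT j x).val = (-1) ^ j * x := by
  rw [signedT]
  rcases Nat.even_or_odd j with h | h
  · simp [Nat.even_iff.mp h, h.neg_one_pow]
  · simp [Nat.odd_iff.mp h, h.neg_one_pow]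

@[simp] theorem signedT_cost (j : ℕ) (x : K) : (signedT j x).cost = 1 := by
  rw [signedT]; split <;> rfl

theorem detT_val (k : ℕ) (A : Matrix (Fin k) (Fin k) K) : (detT k A).val = A.det := by
  induction k with
  | zero => simp [detT]
  | succ k ih =>
    rw [detT, sumT_val, Matrix.det_succ_row_zero]
    refine Finset.sum_congr rfl fun j _ => ?_
    simp [signedT_val, ih, mul_assoc]

/-- Laplace expansion takes factorially many steps, but the number depends on k alone, and the
dimension is fixed. -/
theorem exists_detT_cost_le (k : ℕ) :
    ∃ c : ℕ, ∀ (K : Type) [CommRing K] (A : Matrix (Fin k) (Fin k) K), (detT k A).cost ≤ c := by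
  induction k with
  | zero => exact ⟨1, fun K _ A => le_rfl⟩
  | succ k ih =>
    obtain ⟨c, hc⟩ := ih
    refine ⟨_, fun K _ A => sumT_cost_le (k + 1) _ (c := k * k + c + 3) fun j => ?_⟩
    simp only [cost_bind, cost_charge, cost_prim, signedT_cost]
    have := hc K (A.submatrix Fin.succ j.succAbove)
    omega

end TimedLemmas

/-! ### Ridges as label lists -/

/-- The lists obtained from `l` by removing one entry. -/
def faceKeys : List ℕ → List (List ℕ)
  | [] => []
  | v :: vs => vs :: (faceKeys vs).map (v :: ·)

theorem sublist_of_mem_faceKeys {l e : List ℕ} (h : e ∈ faceKeys l) :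
    e.Sublist l := by
  induction l generalizing e with
  | nil => simp [faceKeys] at h
  | cons v vs ih =>
    simp only [faceKeys, List.mem_cons, List.mem_map] at h
    rcases h with rfl | ⟨a, ha, rfl⟩
    · simp
    · exact (ih ha).cons_cons v

theorem nodup_faceKeys {l : List ℕ} (h : l.Nodup) : (faceKeys l).Nodup := by
  induction l with
  | nil => simp [faceKeys]
  | cons v vs ih =>
    rw [List.nodup_cons] at h
    rw [faceKeys, List.nodup_cons]
    refine ⟨fun hm => ?_, (ih h.2).map fun a b hab => (List.cons.inj hab).2⟩
    obtain ⟨a, -, rfl⟩ := List.mem_map.mp hm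
    exact h.1 List.mem_cons_self

/-- Every list occurs an even number of times: a chain that vanishes modulo two. -/
def EvenCount (L : List (List ℕ)) : Prop := ∀ e, Even (L.count e)

theorem EvenCount.of_perm {L M : List (List ℕ)} (h : L.Perm M) (hM : EvenCount M) :
    EvenCount L := fun e => by rw [h.count_eq]; exact hM e

theorem EvenCount.append {L M : List (List ℕ)} (hL : EvenCount L) (hM : EvenCount M) :
    EvenCount (L ++ M) := fun e => by rw [List.count_append]; exact (hL e).add (hM e)

theorem EvenCount.double (L : List (List ℕ)) : EvenCount (L ++ L) := fun e => by
  rw [List.count_append]; exact ⟨_, rfl⟩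

theorem EvenCount.of_append {L M : List (List ℕ)} (h : EvenCount (L ++ M)) (hM : EvenCount M) :
    EvenCount L := fun e => by
  have := h e
  rw [List.count_append, Nat.even_add] at this
  exact this.mpr (hM e)

theorem EvenCount.map {L : List (List ℕ)} (h : EvenCount L) {f : List ℕ → List ℕ}
    (hf : Function.Injective f) : EvenCount (L.map f) := fun e => by
  by_cases he : e ∈ L.map f
  · obtain ⟨a, -, rfl⟩ := List.mem_map.mp he
    rw [List.count_map_of_injective _ _ hf]
    exact h a
  · rw [List.count_eq_zero_of_not_mem he]
    exact Even.zero

theorem flatMap_cons_perm {α β : Type} (L : List α) (g : α → β) (f : α → List β) :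
    (L.flatMap fun x => g x :: f x).Perm (L.map g ++ L.flatMap f) := by
  induction L with
  | nil => simp
  | cons x xs ih =>
    simp only [List.flatMap_cons, List.map_cons, List.cons_append]
    refine List.Perm.cons _ ?_
    refine (ih.append_left _).trans ?_
    rw [← List.append_assoc, ← List.append_assoc]
    exact List.perm_append_comm.append_right _

/-- The boundary of the boundary vanishes modulo two. -/
theorem evenCount_flatMap_faceKeys_faceKeys (l : List ℕ) :
    EvenCount ((faceKeys l).flatMap faceKeys) := by
  induction l with
  | nil => intro e; simp [faceKeys]
  | cons v vs ih =>
    -- For the cone v * σ this is ∂∂(v * σ) = ∂σ + ∂(v * ∂σ) = ∂σ + ∂σ + v * ∂∂σ.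
    have e : ((faceKeys (v :: vs)).flatMap faceKeys).Perm
        ((faceKeys vs ++ faceKeys vs) ++ ((faceKeys vs).flatMap faceKeys).map (v :: ·)) := by
      simp only [faceKeys, List.flatMap_cons, List.flatMap_map, List.append_assoc]
      refine List.Perm.append_left _ ?_
      refine (flatMap_cons_perm _ (fun a => a) _).trans ?_
      rw [List.map_id', List.map_flatMap]
    exact .of_perm e ((EvenCount.double _).append (ih.map fun a b h => (List.cons.inj h).2))

theorem evenCount_flatMap_flatMap (L : List (List ℕ)) :
    EvenCount ((L.flatMap faceKeys).flatMap faceKeys) := by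
  rw [List.flatMap_assoc]
  induction L with
  | nil => intro e; simp
  | cons x xs ih =>
    rw [List.flatMap_cons]
    exact (evenCount_flatMap_faceKeys_faceKeys x).append ih

/-! ### Sorting and cancelling ridges -/

section Ridges

variable {n : ℕ} {K : Type}

/-- The labels of a list of vertices. -/
def labels (vs : List (Vertex n K)) : List ℕ := vs.map Vertex.idx

theorem list_cons_le_cons {a b : ℕ} {l m : List ℕ} :
    a :: l ≤ b :: m ↔ a < b ∨ a = b ∧ l ≤ m := by
  rw [← not_lt, ← not_lt, List.cons_lt_cons_iff]
  rcases lt_trichotomy a b with h | h | h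
  · simp [h, h.not_gt, h.ne']
  · simp [h]
  · simp [h, h.not_gt, h.ne']

theorem lexLeT_val (us vs : List (Vertex n K)) :
    (lexLeT us vs).val = decide (labels us ≤ labels vs) := by
  induction us generalizing vs with
  | nil => simpa [lexLeT, labels] using not_lt.mp (List.not_lt_nil _)
  | cons u us ih =>
    match vs with
    | [] => simp [lexLeT, labels]
    | v :: vs =>
      simp only [labels] at ih
      simp only [lexLeT, labels, List.map_cons, val_bind, val_prim]
      rcases lt_trichotomy u.idx v.idx with h | h | h
      · simp [h, list_cons_le_cons]
      · simp only [h, lt_irrefl, decide_false, Bool.false_eq_true, if_false, val_bind, val_prim,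
          ih, list_cons_le_cons, false_or, true_and]
        exact decide_eq_decide.mpr Iff.rfl
      · simp [h, h.not_gt, list_cons_le_cons, h.ne', -not_le]

theorem lexLeT_cost_le (us vs : List (Vertex n K)) :
    (lexLeT us vs).cost ≤ 3 * us.length + 1 := by
  induction us generalizing vs with
  | nil => simp [lexLeT]
  | cons u us ih =>
    match vs with
    | [] => simp [lexLeT]
    | v :: vs =>
      have := ih vs
      simp only [lexLeT, cost_bind, cost_prim, val_prim, List.length_cons]
      by_cases h : u.idx < v.idx
      · simp only [h, decide_true, if_true, cost_prim]
        omega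
      · by_cases h' : v.idx < u.idx <;>
        · simp only [h, h', decide_true, decide_false, Bool.false_eq_true, if_true, if_false,
            cost_bind, cost_prim, val_prim]
          omega

theorem ridgeLeT_val (r s : Ridge n K) :
    (ridgeLeT r s).val = decide (labels r.verts ≤ labels s.verts) := lexLeT_val _ _

theorem ridgeEqT_val (r s : Ridge n K) :
    (ridgeEqT r s).val = decide (labels r.verts = labels s.verts) := by
  simp only [ridgeEqT, val_bind, ridgeLeT_val]
  by_cases h : labels r.verts ≤ labels s.verts
  · simp only [h, decide_true, if_true, ridgeLeT_val, decide_eq_decide]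
    exact ⟨fun h' => le_antisymm h h', fun h' => h'.ge⟩
  · have : labels r.verts ≠ labels s.verts := fun h' => h h'.le
    simp [h, this]

theorem ridgeEqT_cost_le {k : ℕ} (r s : Ridge n K) (hr : r.verts.length ≤ k)
    (hs : s.verts.length ≤ k) : (ridgeEqT r s).cost ≤ 6 * k + 3 := by
  have h1 := lexLeT_cost_le r.verts s.verts
  have h2 := lexLeT_cost_le s.verts r.verts
  simp only [ridgeEqT, cost_bind, ridgeLeT]
  split
  · omega
  · simp only [cost_prim]; omega

theorem sortT_ridgeLeT_pairwise (L : List (Ridge n K)) :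
    (sortT ridgeLeT L).val.Pairwise fun r s => labels r.verts ≤ labels s.verts := by
  have := sortT_pairwise (ridgeLeT (n := n) (K := K))
    (fun a b c => by simp only [ridgeLeT_val, decide_eq_true_eq]; exact le_trans)
    (fun a b => by simp only [ridgeLeT_val, Bool.or_eq_true, decide_eq_true_eq]
                   exact le_total _ _) L
  simpa only [ridgeLeT_val, decide_eq_true_eq] using this

theorem cancelPairsT_sublist (L : List (Ridge n K)) : (cancelPairsT L).val.Sublist L := by
  induction L using cancelPairsT.induct with
  | case1 => simp [cancelPairsT]
  | case2 r => simp [cancelPairsT]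
  | case3 r s rs h1 h2 =>
    simp only [cancelPairsT, val_bind]
    split
    · exact (h1.cons _).cons _
    · exact h2.cons_cons _

theorem cancelPairsT_cost_le {k : ℕ} (L : List (Ridge n K)) (hk : ∀ r ∈ L, r.verts.length ≤ k) :
    (cancelPairsT L).cost ≤ (6 * k + 4) * L.length + 1 := by
  induction L using cancelPairsT.induct with
  | case1 => simp [cancelPairsT]
  | case2 r => simp [cancelPairsT]
  | case3 r s rs h1 h2 =>
    have e := ridgeEqT_cost_le (k := k) r s (hk _ (by simp)) (hk _ (by simp))
    have h1 := h1 fun a ha => hk a (by simp [ha])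
    have h2 := h2 fun a ha => hk a (List.mem_cons_of_mem _ ha)
    simp only [List.length_cons] at h2 ⊢
    simp only [cancelPairsT, cost_bind]
    split
    · linarith
    · simp only [cost_bind, cost_prim]
      linarith

/-- In a sorted list equal ridges are adjacent, so every comparison that fails certifies a strict
increase. Whatever is cancelled leaves in equal pairs, collected in D, so the output represents the
same chain modulo two. No bound on the multiplicities is required. -/
theorem cancelPairsT_spec (L : List (Ridge n K))
    (hL : L.Pairwise fun r s => labels r.verts ≤ labels s.verts) :
    (cancelPairsT L).val.Pairwise (fun r s => labels r.verts < labels s.verts) ∧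
    ∃ D : List (List ℕ), (L.map fun r => labels r.verts).Perm
      (((cancelPairsT L).val.map fun r => labels r.verts) ++ (D ++ D)) := by
  induction L using cancelPairsT.induct with
  | case1 => exact ⟨by simp [cancelPairsT], [], by simp [cancelPairsT]⟩
  | case2 r => exact ⟨by simp [cancelPairsT], [], by simp [cancelPairsT]⟩
  | case3 r s rs h1 h2 =>
    have hs := (List.pairwise_cons.mp hL).2
    obtain ⟨p1, D1, q1⟩ := h1 (List.pairwise_cons.mp hs).2
    obtain ⟨p2, D2, q2⟩ := h2 hs
    simp only [cancelPairsT, val_bind, ridgeEqT_val]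
    by_cases h : labels r.verts = labels s.verts
    · simp only [h, decide_true, if_true]
      refine ⟨p1, labels s.verts :: D1, ?_⟩
      simp only [List.map_cons, h, List.cons_append]
      refine ((q1.cons _).cons _).trans ?_
      rw [← Multiset.coe_eq_coe]
      simp only [← Multiset.cons_coe, ← Multiset.coe_add, Multiset.add_cons]
    · simp only [h, decide_false, Bool.false_eq_true, if_false, val_bind, val_prim]
      refine ⟨List.pairwise_cons.mpr ⟨fun a ha => ?_, p2⟩, D2, ?_⟩
      · have ha := (cancelPairsT_sublist _).subset ha
        have hrs : labels r.verts < labels s.verts :=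
          lt_of_le_of_ne ((List.pairwise_cons.mp hL).1 s (by simp)) h
        rcases List.mem_cons.mp ha with rfl | ha
        · exact hrs
        · exact hrs.trans_le ((List.pairwise_cons.mp hs).1 a ha)
      · exact q2.cons _

theorem ridgesT_length (vs : List (Vertex n K)) : (ridgesT vs).val.length = vs.length := by
  induction vs with
  | nil => rfl
  | cons v vs ih => simp [ridgesT, mapT_val, ih]

theorem ridgesT_cost_le (vs : List (Vertex n K)) :
    (ridgesT vs).cost ≤ (2 * vs.length + 2) * (vs.length + 1) := by
  induction vs with
  | nil => simp [ridgesT]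
  | cons v vs ih =>
    have := mapT_cost_le (fun r : Ridge n K => (prim ⟨v :: r.verts, r.opp⟩ : Timed (Ridge n K)))
      (l := (ridgesT vs).val) (c := 1) (fun x _ => le_rfl)
    rw [ridgesT_length] at this
    simp only [ridgesT, cost_bind, cost_prim, List.length_cons]
    nlinarith

theorem ridgesT_map_labels (vs : List (Vertex n K)) :
    ((ridgesT vs).val.map fun r => labels r.verts) = faceKeys (labels vs) := by
  induction vs with
  | nil => rfl
  | cons v vs ih =>
    simp only [labels] at ih
    simp only [ridgesT, val_bind, val_prim, mapT_val, List.map_cons, List.map_map, labels, faceKeys,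
      ← ih]
    rfl

theorem ridgesT_perm {vs : List (Vertex n K)} {r : Ridge n K} (h : r ∈ (ridgesT vs).val) :
    (r.opp :: r.verts).Perm vs ∧ r.verts.Sublist vs := by
  induction vs generalizing r with
  | nil => simp [ridgesT] at h
  | cons v vs ih =>
    simp only [ridgesT, val_bind, val_prim, mapT_val, List.mem_cons, List.mem_map] at h
    rcases h with rfl | ⟨s, hs, rfl⟩
    · simp
    · obtain ⟨h1, h2⟩ := ih hs
      exact ⟨(List.Perm.swap _ _ _).trans (h1.cons v), h2.cons_cons _⟩

end Ridges

variable {n : ℕ}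

/-! ### Affine functions and the facet spanned by given vertices -/

/-- The affine function with coefficients `c`. -/
def aff (c : Fin (n + 1) → ℝ) (x : Fin n → ℝ) : ℝ :=
  ∑ j, c j * (Matrix.vecCons 1 x : Fin (n + 1) → ℝ) j

theorem evalT_val (c : Fin (n + 1) → ℝ) (x : Fin n → ℝ) : (evalT c x).val = aff c x := by
  simp [evalT, sumT_val, aff]

theorem evalT_cost_le (c : Fin (n + 1) → ℝ) (x : Fin n → ℝ) :
    (evalT c x).cost ≤ 4 * (n + 1) + 1 :=
  sumT_cost_le _ _ fun _ => le_rfl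

theorem aff_neg (c : Fin (n + 1) → ℝ) (x : Fin n → ℝ) : aff (fun j => -c j) x = -aff c x := by
  simp [aff]

theorem aff_sub_mul (a b : ℝ) (c d : Fin (n + 1) → ℝ) (x : Fin n → ℝ) :
    aff (fun j => a * c j - b * d j) x = a * aff c x - b * aff d x := by
  simp only [aff, Finset.mul_sum, ← Finset.sum_sub_distrib]
  exact Finset.sum_congr rfl fun j _ => by ring

theorem aff_eq (c : Fin (n + 1) → ℝ) (x : Fin n → ℝ) :
    aff c x = c 0 + ∑ i : Fin n, c i.succ * x i := by
  simp [aff, Fin.sum_univ_succ]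

/-- The point `pt i` as a vertex with label `i`. -/
def vert (pt : ℕ → Fin n → ℝ) (i : ℕ) : Vertex n ℝ := ⟨i, pt i⟩

theorem labels_map_vert (pt : ℕ → Fin n → ℝ) (l : List ℕ) : labels (l.map (vert pt)) = l := by
  simp [labels, vert, Function.comp_def]

/-- No `n + 1` of the points `pt 0, …, pt m` lie on a hyperplane. -/
def GeneralPosition (pt : ℕ → Fin n → ℝ) (m : ℕ) : Prop :=
  ∀ f : Fin (n + 1) → ℕ, Function.Injective f → (∀ i, f i ≤ m) →
    Matrix.det (fun i => Matrix.vecCons 1 (pt (f i)) : Matrix (Fin (n + 1)) (Fin (n + 1)) ℝ) ≠ 0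

/-- The rows of the matrix whose cofactors define the facet with the vertices labelled `l`. -/
def rows (pt : ℕ → Fin n → ℝ) (l : List ℕ) : Matrix (Fin n) (Fin (n + 1)) ℝ :=
  fun i => Matrix.vecCons 1 (pt (l.getD i 0))

/-- The square matrix with the additional first row `(1, x)`. -/
def bordered (x : Fin n → ℝ) (M : Matrix (Fin n) (Fin (n + 1)) ℝ) :
    Matrix (Fin (n + 1)) (Fin (n + 1)) ℝ :=
  Matrix.of (Matrix.vecCons (Matrix.vecCons 1 x) fun i j => M i j)

/-- Laplace expansion along the added row: the computed coefficients are those of a determinant,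
whose zeros are governed by general position. -/
theorem aff_cofactors (M : Matrix (Fin n) (Fin (n + 1)) ℝ) (x : Fin n → ℝ) :
    aff (fun j => (-1) ^ (j : ℕ) * (M.submatrix id j.succAbove).det) x =
      (bordered x M).det := by
  rw [Matrix.det_succ_row_zero, aff]
  exact Finset.sum_congr rfl fun j _ => mul_right_comm _ _ _

section MkFacet

variable {pt : ℕ → Fin n → ℝ} {m : ℕ} {l : List ℕ} {o : ℕ}

theorem injective_cons_getD (hl : l.length = n) (hn : l.Nodup) (ho : o ∉ l) :
    Function.Injective (Fin.cons o fun i : Fin n => l.getD i 0 : Fin (n + 1) → ℕ) := by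
  subst hl
  rw [Fin.cons_injective_iff]
  simp only [List.getD_eq_getElem?_getD, Set.mem_range, not_exists]
  refine ⟨fun i hi => ho ?_, fun i j hij => ?_⟩
  · rw [List.getElem?_eq_getElem i.2, Option.getD_some] at hi
    exact hi ▸ List.getElem_mem _
  · simp only [List.getElem?_eq_getElem i.2, List.getElem?_eq_getElem j.2, Option.getD_some] at hij
    exact Fin.ext ((List.Nodup.getElem_inj_iff hn).mp hij)

theorem cons_getD_le (hl : l.length = n) (hlm : ∀ i ∈ l, i ≤ m) (hom : o ≤ m) (i : Fin (n + 1)) :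
    (Fin.cons o fun i : Fin n => l.getD i 0 : Fin (n + 1) → ℕ) i ≤ m := by
  subst hl
  refine Fin.cases (by simpa) (fun i => ?_) i
  simp only [Fin.cons_succ, List.getD_eq_getElem?_getD, List.getElem?_eq_getElem i.2,
    Option.getD_some]
  exact hlm _ (List.getElem_mem _)

theorem cons_rows (pt : ℕ → Fin n → ℝ) (l : List ℕ) (o : ℕ) :
    bordered (pt o) (rows pt l) = Matrix.of fun i =>
      Matrix.vecCons 1 (pt ((Fin.cons o fun i : Fin n => l.getD i 0 : Fin (n + 1) → ℕ) i)) := by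
  funext i
  refine Fin.cases rfl (fun i => rfl) i

theorem det_cons_rows_ne (hgp : GeneralPosition pt m) (hl : l.length = n) (hn : l.Nodup)
    (hlm : ∀ i ∈ l, i ≤ m) (ho : o ∉ l) (hom : o ≤ m) :
    (bordered (pt o) (rows pt l)).det ≠ 0 := by
  rw [cons_rows]
  exact hgp _ (injective_cons_getD hl hn ho) (cons_getD_le hl hlm hom)

theorem det_cons_rows_eq_zero (hl : l.length = n) (ho : o ∈ l) :
    (bordered (pt o) (rows pt l)).det = 0 := by
  obtain ⟨i, hi, rfl⟩ := List.getElem_of_mem ho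
  refine Matrix.det_zero_of_row_eq (i := 0) (j := Fin.succ ⟨i, hl ▸ hi⟩) (Fin.succ_ne_zero _).symm ?_
  funext j
  simp [bordered, rows, hi]

/-- An affine function that vanishes on the points labelled `l` is determined up to a factor. -/
theorem aff_proportional (hgp : GeneralPosition pt m) (hl : l.length = n) (hn : l.Nodup)
    (hlm : ∀ i ∈ l, i ≤ m) (ho : o ∉ l) (hom : o ≤ m) {c d : Fin (n + 1) → ℝ}
    (hc : ∀ i ∈ l, aff c (pt i) = 0) (hd : ∀ i ∈ l, aff d (pt i) = 0) (x : Fin n → ℝ) :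
    aff c x * aff d (pt o) = aff d x * aff c (pt o) := by
  -- This combination vanishes at `pt o` and at the n points labelled `l`; in homogeneous
  -- coordinates these n + 1 points form an invertible matrix.
  have key : (fun j => aff d (pt o) * c j - aff c (pt o) * d j) = 0 := by
    refine Matrix.eq_zero_of_mulVec_eq_zero (det_cons_rows_ne hgp hl hn hlm ho hom) ?_
    have e : ∀ w : Fin (n + 1) → ℝ, ∀ x, (Matrix.vecCons 1 x : Fin (n + 1) → ℝ) ⬝ᵥ w = aff w x :=
      fun w x => Finset.sum_congr rfl fun j _ => mul_comm _ _
    funext i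
    refine Fin.cases ?_ (fun i => ?_) i
    · refine (e _ (pt o)).trans ?_
      rw [aff_sub_mul, Pi.zero_apply]
      ring
    · have hm : l.getD i 0 ∈ l := by
        rw [List.getD_eq_getElem _ _ (hl ▸ i.2)]
        exact List.getElem_mem _
      refine (e _ (pt (l.getD i 0))).trans ?_
      rw [aff_sub_mul, hc _ hm, hd _ hm, Pi.zero_apply]
      ring
  have := aff_sub_mul (aff d (pt o)) (aff c (pt o)) c d x
  rw [key] at this
  simp only [aff, Pi.zero_apply, zero_mul, Finset.sum_const_zero] at this
  simp only [aff]
  linarith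

theorem mkFacetT_verts (vs : List (Vertex n ℝ)) (opp : Vertex n ℝ) :
    (mkFacetT vs opp).val.verts = vs := by
  simp only [mkFacetT, val_bind]
  split <;> rfl

theorem mkFacetT_coef (pt : ℕ → Fin n → ℝ) (l : List ℕ) (hl : l.length = n) (o : ℕ) :
    (∃ ε : ℝ, ε ≠ 0 ∧ ∀ x, aff (mkFacetT (l.map (vert pt)) (vert pt o)).val.coef x =
      ε * (bordered x (rows pt l)).det) ∧
    aff (mkFacetT (l.map (vert pt)) (vert pt o)).val.coef (pt o) ≤ 0 := by
  -- The two default values, a vertex in the algorithm and the label 0 in `rows`, are never reached,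
  -- since `l` has exactly n entries.
  have hM : (fun i : Fin n =>
      (Matrix.vecCons 1 ((l.map (vert pt)).getD i ⟨0, 0⟩).pt : Fin (n + 1) → ℝ)) = rows pt l := by
    subst hl
    funext i
    simp [rows, vert]
  simp only [mkFacetT, val_bind, arrayT_val, signedT_val, detT_val, hM, evalT_val, aff_cofactors,
    val_prim, vert]
  by_cases h : 0 < (bordered (pt o) (rows pt l)).det
  · simp only [h, decide_true, if_true, val_bind, arrayT_val, val_prim, aff_neg, aff_cofactors]
    exact ⟨⟨-1, by norm_num, fun x => by ring⟩, by linarith⟩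
  · simp only [h, decide_false, Bool.false_eq_true, if_false, val_prim, aff_cofactors]
    exact ⟨⟨1, one_ne_zero, fun x => by ring⟩, not_lt.mp h⟩

end MkFacet

/-- `F` is a facet with vertices among `pt 0, …, pt (t - 1)`, all of which satisfy its inequality,
and no other point among `pt 0, …, pt m` lies on its hyperplane. -/
structure IsFacet (pt : ℕ → Fin n → ℝ) (m t : ℕ) (F : Facet n ℝ) : Prop where
  verts_eq : F.verts = (labels F.verts).map (vert pt)
  pairwise : (labels F.verts).Pairwise (· > ·)
  length_eq : (labels F.verts).length = n
  lt : ∀ i ∈ labels F.verts, i < t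
  eq_zero : ∀ i ∈ labels F.verts, aff F.coef (pt i) = 0
  ne_zero : ∀ i ≤ m, i ∉ labels F.verts → aff F.coef (pt i) ≠ 0
  nonpos : ∀ i < t, aff F.coef (pt i) ≤ 0

theorem IsFacet.nodup {pt : ℕ → Fin n → ℝ} {m t : ℕ} {F : Facet n ℝ} (h : IsFacet pt m t F) :
    (labels F.verts).Nodup := h.pairwise.imp fun h => ne_of_gt h

/-- The algorithm orients its inequality by the single point `o`. If some valid affine function `h`
vanishes on `l` and is negative at `o`, then by proportionality the computed function is a positive
multiple of it, hence valid at all points. -/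
theorem isFacet_mkFacetT {pt : ℕ → Fin n → ℝ} {m t : ℕ} {l : List ℕ} {o : ℕ}
    (hgp : GeneralPosition pt m) (hl : l.length = n) (hp : l.Pairwise (· > ·))
    (ht : t ≤ m + 1) (hlt : ∀ i ∈ l, i < t) (ho : o ∉ l) (hot : o < t) (h : Fin (n + 1) → ℝ)
    (h0 : ∀ i ∈ l, aff h (pt i) = 0) (ho' : aff h (pt o) < 0) (hle : ∀ i < t, aff h (pt i) ≤ 0) :
    IsFacet pt m t (mkFacetT (l.map (vert pt)) (vert pt o)).val := by
  obtain ⟨⟨ε, hε, hdet⟩, hneg⟩ := mkFacetT_coef pt l hl o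
  have hlm : ∀ i ∈ l, i ≤ m := fun i hi => by have := hlt i hi; omega
  have hn : l.Nodup := hp.imp fun h => ne_of_gt h
  have hz : ∀ i ∈ l, aff (mkFacetT (l.map (vert pt)) (vert pt o)).val.coef (pt i) = 0 :=
    fun i hi => by rw [hdet, det_cons_rows_eq_zero hl hi, mul_zero]
  have hnz : ∀ i ≤ m, i ∉ l → aff (mkFacetT (l.map (vert pt)) (vert pt o)).val.coef (pt i) ≠ 0 :=
    fun i hi hil => by
      rw [hdet]
      exact mul_ne_zero hε (det_cons_rows_ne hgp hl hn hlm hil hi)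
  have hneg' := lt_of_le_of_ne hneg (hnz o (by omega) ho)
  have hlab : labels (mkFacetT (l.map (vert pt)) (vert pt o)).val.verts = l := by
    rw [mkFacetT_verts, labels_map_vert]
  refine ⟨?_, ?_, ?_, ?_, ?_, ?_, ?_⟩
  · rw [hlab, mkFacetT_verts]
  all_goals try rw [hlab]
  · exact hp
  · exact hl
  · exact hlt
  · exact hz
  · exact hnz
  · intro i hi
    have := aff_proportional hgp hl hn hlm ho (by omega) hz h0 (pt i)
    have := hle i hi
    by_contra! hpos
    nlinarith [mul_neg_of_pos_of_neg hpos ho', mul_nonneg_of_nonpos_of_nonpos this hneg]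

/-! ### The invariant of the incremental construction -/

/-- The list of facets of the polytope with the vertices `pt 0, …, pt (t - 1)`: different facets,
which form a cycle modulo two. -/
structure Invariant (pt : ℕ → Fin n → ℝ) (m t : ℕ) (Fs : List (Facet n ℝ)) : Prop where
  isFacet : ∀ F ∈ Fs, IsFacet pt m t F
  nodup : (Fs.map fun F => labels F.verts).Nodup
  cycle : EvenCount (Fs.flatMap fun F => faceKeys (labels F.verts))

theorem invariant_simplexT {pt : ℕ → Fin n → ℝ} {m t : ℕ} {l : List ℕ} (hgp : GeneralPosition pt m)
    (hl : l.length = n + 1) (hp : l.Pairwise (· > ·)) (ht : t ≤ m + 1) (hlt : ∀ i, i < t ↔ i ∈ l) :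
    Invariant pt m t (simplexT (l.map (vert pt))).val := by
  have hval : (simplexT (l.map (vert pt))).val =
      (ridgesT (l.map (vert pt))).val.map fun r => (mkFacetT r.verts r.opp).val := by
    simp [simplexT, mapT_val]
  have hkeys : ((simplexT (l.map (vert pt))).val.map fun F => labels F.verts) = faceKeys l := by
    rw [hval, List.map_map, ← labels_map_vert pt l, ← ridgesT_map_labels, labels_map_vert]
    exact List.map_congr_left fun r _ => by simp [mkFacetT_verts]
  have hn : l.Nodup := hp.imp fun h => ne_of_gt h
  refine ⟨fun F hF => ?_, ?_, ?_⟩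
  · rw [hval] at hF
    obtain ⟨r, hr, rfl⟩ := List.mem_map.mp hF
    obtain ⟨hperm, hsub⟩ := ridgesT_perm hr
    have hvs : r.verts = (labels r.verts).map (vert pt) := by
      obtain ⟨l', -, e⟩ := List.sublist_map_iff.mp hsub
      rw [e, labels_map_vert]
    obtain ⟨o, -, hopp⟩ := List.mem_map.mp (hperm.subset List.mem_cons_self)
    have hperm' : (o :: labels r.verts).Perm l := by
      have := hperm.map Vertex.idx
      rw [List.map_cons, ← hopp] at this
      exact this.trans (by rw [← labels, labels_map_vert])
    have hsub' : (labels r.verts).Sublist l := by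
      have := hsub.map Vertex.idx
      rwa [← labels, ← labels, labels_map_vert] at this
    have hlen : (labels r.verts).length = n := by
      have := hperm'.length_eq
      rw [List.length_cons, hl] at this
      omega
    have ho : o ∉ labels r.verts := (List.nodup_cons.mp (hperm'.nodup_iff.mpr hn)).1
    have hmem : ∀ i, i < t → i = o ∨ i ∈ labels r.verts := fun i hi =>
      List.mem_cons.mp (hperm'.symm.subset ((hlt i).mp hi))
    have hlt' : ∀ i ∈ labels r.verts, i < t := fun i hi => (hlt i).mpr (hsub'.subset hi)
    have hot : o < t := (hlt o).mpr (hperm'.subset List.mem_cons_self)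
    have hlm : ∀ i ∈ labels r.verts, i ≤ m := fun i hi => by have := hlt' i hi; omega
    rw [hvs, ← hopp]
    obtain ⟨⟨ε, hε, hdet⟩, hneg⟩ := mkFacetT_coef pt (labels r.verts) hlen o
    have hz : ∀ i ∈ labels r.verts,
        aff (mkFacetT ((labels r.verts).map (vert pt)) (vert pt o)).val.coef (pt i) = 0 :=
      fun i hi => by rw [hdet, det_cons_rows_eq_zero hlen hi, mul_zero]
    -- Every point of the simplex other than `o` lies on the hyperplane, so the computed function is
    -- its own witness of validity.
    refine isFacet_mkFacetT hgp hlen (hp.sublist hsub') ht hlt' ho hot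
      (mkFacetT ((labels r.verts).map (vert pt)) (vert pt o)).val.coef hz
      (lt_of_le_of_ne hneg ?_) fun i hi => ?_
    · rw [hdet]
      exact mul_ne_zero hε (det_cons_rows_ne hgp hlen (hn.sublist hsub') hlm ho (by omega))
    · rcases hmem i hi with rfl | h
      · exact hneg
      · exact (hz i h).le
  · rw [hkeys]
    exact nodup_faceKeys hn
  · have := evenCount_flatMap_faceKeys_faceKeys l
    rwa [← hkeys, List.flatMap_map] at this

theorem beyondT_val (x : Fin n → ℝ) (F : Facet n ℝ) :
    (beyondT x F).val = decide (0 < aff F.coef x) := by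
  simp [beyondT, evalT_val]

/-- Both facets have n labels in decreasing order, so sharing a ridge and its opposite vertex forces
equal label lists. This excludes that the kept facet at a horizon ridge contains the opposite
vertex. -/
theorem IsFacet.eq_of_labels {pt : ℕ → Fin n → ℝ} {m t : ℕ} {F G : Facet n ℝ}
    (hF : IsFacet pt m t F) (hG : IsFacet pt m t G) {o : ℕ} {k : List ℕ}
    (hk : (o :: k).Perm (labels F.verts)) (ho : o ∈ labels G.verts) (hkG : k ⊆ labels G.verts) :
    labels F.verts = labels G.verts := by
  have hnd : (o :: k).Nodup := hk.nodup_iff.mpr hF.nodup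
  have hsub : o :: k ⊆ labels G.verts := List.cons_subset.mpr ⟨ho, hkG⟩
  have hperm : (o :: k).Perm (labels G.verts) :=
    (hnd.subperm hsub).perm_of_length_le (by rw [hk.length_eq, hF.length_eq, hG.length_eq])
  exact (hk.symm.trans hperm).eq_of_pairwise (fun a b _ _ h1 h2 => absurd h1 (lt_asymm h2))
    hF.pairwise hG.pairwise

/-- A new facet: the ridge with labels `k` lies in a facet `F` that `pt t` is beyond, and in a
facet `G` that it is not beyond. -/
theorem isFacet_cone {pt : ℕ → Fin n → ℝ} {m t : ℕ} (hgp : GeneralPosition pt m) (ht : t ≤ m)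
    {F G : Facet n ℝ} (hF : IsFacet pt m t F) (hG : IsFacet pt m t G)
    (hFt : 0 < aff F.coef (pt t)) (hGt : aff G.coef (pt t) ≤ 0) {o : ℕ} {k : List ℕ}
    (hk : (o :: k).Perm (labels F.verts)) (hkF : k.Sublist (labels F.verts))
    (hkG : k ⊆ labels G.verts) (ho : o ∉ labels G.verts) :
    IsFacet pt m (t + 1) (mkFacetT ((t :: k).map (vert pt)) (vert pt o)).val := by
  have hlen : (t :: k).length = n := by
    rw [← hF.length_eq, ← hk.length_eq, List.length_cons, List.length_cons]
  have hot : o < t := hF.lt o (hk.subset List.mem_cons_self)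
  have hkt : ∀ i ∈ k, i < t := fun i hi => hF.lt i (hkF.subset hi)
  have hok : o ∉ k := (List.nodup_cons.mp (hk.nodup_iff.mpr hF.nodup)).1
  refine isFacet_mkFacetT hgp hlen (List.pairwise_cons.mpr ⟨hkt, hF.pairwise.sublist hkF⟩)
    (by omega) ?_ ?_ (by omega)
    -- The member of the pencil of hyperplanes through the ridge that passes through `pt t`. Both F
    -- and G enter with nonnegative weights, so it inherits validity at the old points; it is
    -- negative at `o`, where F vanishes and G does not.
    (fun j => aff F.coef (pt t) * G.coef j - aff G.coef (pt t) * F.coef j) ?_ ?_ ?_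
  · intro i hi
    rcases List.mem_cons.mp hi with rfl | hi
    · omega
    · have := hkt i hi; omega
  · rw [List.mem_cons, not_or]
    exact ⟨hot.ne, hok⟩
  · intro i hi
    rw [aff_sub_mul]
    rcases List.mem_cons.mp hi with rfl | hi
    · ring
    · rw [hF.eq_zero i (hkF.subset hi), hG.eq_zero i (hkG hi)]
      ring
  · rw [aff_sub_mul, hF.eq_zero o (hk.subset List.mem_cons_self), mul_zero, sub_zero]
    exact mul_neg_of_pos_of_neg hFt
      (lt_of_le_of_ne (hG.nonpos o hot) (hG.ne_zero o (by omega) ho))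
  · intro i hi
    rw [aff_sub_mul]
    rcases Nat.lt_succ_iff_lt_or_eq.mp hi with hi | rfl
    · have h1 := mul_nonpos_of_nonneg_of_nonpos hFt.le (hG.nonpos i hi)
      have h2 := mul_nonneg_of_nonpos_of_nonpos hGt (hF.nonpos i hi)
      linarith
    · linarith [mul_comm (aff F.coef (pt i)) (aff G.coef (pt i))]

/-- The ridges of the facets that `p` is beyond. -/
noncomputable def removedRidges (Fs : List (Facet n ℝ)) (p : Vertex n ℝ) : List (Ridge n ℝ) :=
  (Fs.filter fun F => decide (0 < aff F.coef p.pt)).flatMap fun F => (ridgesT F.verts).val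

/-- The ridges that lie in an odd number of the facets that `p` is beyond. -/
noncomputable def horizon (Fs : List (Facet n ℝ)) (p : Vertex n ℝ) : List (Ridge n ℝ) :=
  (cancelPairsT (sortT ridgeLeT (removedRidges Fs p)).val).val

theorem stepT_val (Fs : List (Facet n ℝ)) (p : Vertex n ℝ) :
    (stepT Fs p).val = ((horizon Fs p).map fun r => (mkFacetT (p :: r.verts) r.opp).val) ++
      Fs.filter fun F => !decide (0 < aff F.coef p.pt) := by
  simp only [stepT, val_bind, partitionT_val, flatMapT_val, mapT_val, appendT_val, beyondT_val]
  rfl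

theorem removedRidges_keys (Fs : List (Facet n ℝ)) (p : Vertex n ℝ) :
    ((removedRidges Fs p).map fun r => labels r.verts) =
      (Fs.filter fun F => decide (0 < aff F.coef p.pt)).flatMap
        fun F => faceKeys (labels F.verts) := by
  simp only [removedRidges, List.map_flatMap, ridgesT_map_labels]

theorem horizon_subset (Fs : List (Facet n ℝ)) (p : Vertex n ℝ) {r : Ridge n ℝ}
    (hr : r ∈ horizon Fs p) : r ∈ removedRidges Fs p :=
  (sortT_perm _ _).subset ((cancelPairsT_sublist _).subset hr)

theorem horizon_spec (Fs : List (Facet n ℝ)) (p : Vertex n ℝ) :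
    ((horizon Fs p).map fun r => labels r.verts).Nodup ∧
    ∃ D : List (List ℕ), ((removedRidges Fs p).map fun r => labels r.verts).Perm
      (((horizon Fs p).map fun r => labels r.verts) ++ (D ++ D)) := by
  obtain ⟨h1, D, h2⟩ := cancelPairsT_spec _ (sortT_ridgeLeT_pairwise (removedRidges Fs p))
  exact ⟨List.pairwise_map.mpr (h1.imp fun h => ne_of_lt h), D,
    ((sortT_perm _ _).map _).symm.trans h2⟩

/-- A horizon ridge occurs once in the cancelled list and an even number of times among the
cancelled pairs, hence an odd number of times in removed facets. Its total count is even, so some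
kept facet G contains it too. -/
theorem Invariant.exists_of_mem_horizon {pt : ℕ → Fin n → ℝ} {m t : ℕ} {Fs : List (Facet n ℝ)}
    (h : Invariant pt m t Fs) {r : Ridge n ℝ} (hr : r ∈ horizon Fs (vert pt t)) :
    ∃ F ∈ Fs, ∃ G ∈ Fs, ∃ o, 0 < aff F.coef (pt t) ∧ aff G.coef (pt t) ≤ 0 ∧
      r.opp = vert pt o ∧ r.verts = (labels r.verts).map (vert pt) ∧
      (o :: labels r.verts).Perm (labels F.verts) ∧ (labels r.verts).Sublist (labels F.verts) ∧
      labels r.verts ⊆ labels G.verts := by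
  obtain ⟨hnd, D, hperm⟩ := horizon_spec Fs (vert pt t)
  obtain ⟨F, hF, hrF⟩ := List.mem_flatMap.mp (horizon_subset _ _ hr)
  rw [List.mem_filter, decide_eq_true_eq] at hF
  have hFf := h.isFacet F hF.1
  obtain ⟨hp, hs⟩ := ridgesT_perm hrF
  have hmem : labels r.verts ∈ (horizon Fs (vert pt t)).map fun r => labels r.verts :=
    List.mem_map.mpr ⟨r, hr, rfl⟩
  have hcycle := h.cycle (labels r.verts)
  have hsplit := (List.filter_append_perm (fun F => decide (0 < aff F.coef (vert pt t).pt))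
    Fs).flatMap_right (fun F => faceKeys (labels F.verts))
  rw [← hsplit.count_eq, List.flatMap_append, List.count_append, ← removedRidges_keys,
    hperm.count_eq, List.count_append, List.count_append,
    List.count_eq_one_of_mem hnd hmem] at hcycle
  have hpos : 0 < List.count (labels r.verts)
      ((Fs.filter fun F => !decide (0 < aff F.coef (vert pt t).pt)).flatMap
        fun F => faceKeys (labels F.verts)) := by
    by_contra! h0
    rw [Nat.le_zero.mp h0] at hcycle
    rw [Nat.even_iff] at hcycle
    omega
  obtain ⟨G, hG, hrG⟩ := List.mem_flatMap.mp (List.count_pos_iff.mp hpos)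
  rw [List.mem_filter, Bool.not_eq_true', decide_eq_false_iff_not, not_lt] at hG
  rw [hFf.verts_eq] at hp hs
  obtain ⟨o, -, hopp⟩ := List.mem_map.mp (hp.subset List.mem_cons_self)
  refine ⟨F, hF.1, G, hG.1, o, hF.2, hG.2, hopp.symm, ?_, ?_, ?_, ?_⟩
  · obtain ⟨l', -, e⟩ := List.sublist_map_iff.mp hs
    rw [e, labels_map_vert]
  · have := hp.map Vertex.idx
    rw [List.map_cons, ← hopp] at this
    exact this.trans (by rw [← labels, labels_map_vert])
  · have := hs.map Vertex.idx
    rwa [← labels, ← labels, labels_map_vert] at this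
  · exact (sublist_of_mem_faceKeys hrG).subset

theorem Invariant.stepT {pt : ℕ → Fin n → ℝ} {m t : ℕ} {Fs : List (Facet n ℝ)}
    (hgp : GeneralPosition pt m) (ht : t ≤ m) (h : Invariant pt m t Fs) :
    Invariant pt m (t + 1) (stepT Fs (vert pt t)).val := by
  obtain ⟨hnd, D, hperm⟩ := horizon_spec Fs (vert pt t)
  have hkept : ∀ G ∈ Fs.filter (fun F => !decide (0 < aff F.coef (vert pt t).pt)),
      G ∈ Fs ∧ aff G.coef (pt t) ≤ 0 := fun G hG => by
    rwa [List.mem_filter, Bool.not_eq_true', decide_eq_false_iff_not, not_lt] at hG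
  have hkeys : (((horizon Fs (vert pt t)).map fun r =>
      (mkFacetT (vert pt t :: r.verts) r.opp).val).map fun F => labels F.verts) =
      ((horizon Fs (vert pt t)).map fun r => labels r.verts).map (t :: ·) := by
    simp only [List.map_map, Function.comp_def, mkFacetT_verts]
    rfl
  rw [stepT_val]
  refine ⟨fun F hF => ?_, ?_, ?_⟩
  · rcases List.mem_append.mp hF with hF | hF
    · obtain ⟨r, hr, rfl⟩ := List.mem_map.mp hF
      obtain ⟨F, hF, G, hG, o, hFt, hGt, hopp, hverts, hp, hs, hkG⟩ := h.exists_of_mem_horizon hr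
      rw [hverts, hopp, ← List.map_cons]
      refine isFacet_cone hgp ht (h.isFacet F hF) (h.isFacet G hG) hFt hGt hp hs hkG fun ho => ?_
      have := (h.isFacet F hF).eq_of_labels (h.isFacet G hG) hp ho hkG
      rw [List.inj_on_of_nodup_map h.nodup hF hG this] at hFt
      exact hFt.not_ge hGt
    · obtain ⟨hF, hFt⟩ := hkept F hF
      have hf := h.isFacet F hF
      exact { hf with
        lt := fun i hi => (hf.lt i hi).trans (Nat.lt_succ_self _)
        nonpos := fun i hi => by
          rcases Nat.lt_succ_iff_lt_or_eq.mp hi with hi | rfl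
          · exact hf.nonpos i hi
          · exact hFt }
  · rw [List.map_append, hkeys]
    refine List.Nodup.append (hnd.map fun a b hab => (List.cons.inj hab).2)
      (h.nodup.sublist (List.filter_sublist.map _)) ?_
    -- New label lists contain t, whereas all labels of the old facets are smaller than t.
    intro k hk hk'
    obtain ⟨a, -, rfl⟩ := List.mem_map.mp hk
    obtain ⟨G, hG, e⟩ := List.mem_map.mp hk'
    have := (h.isFacet G (hkept G hG).1).lt t (e ▸ List.mem_cons_self)
    omega
  -- Let R and Q be the removed and the kept facets. Modulo two H = ∂R, so ∂H = 0 (`h2`) and H + ∂Q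
  -- = ∂R + ∂Q = 0 (`h1`). The new list is t * H + Q, with boundary H + t * ∂H + ∂Q. As t is the
  -- largest label it stands at the head, which matches the recursion of `faceKeys`.
  · generalize hH : ((horizon Fs (vert pt t)).map fun r => labels r.verts) = H at *
    have h2 : EvenCount (H.flatMap faceKeys) := by
      have := evenCount_flatMap_flatMap
        ((Fs.filter fun F => decide (0 < aff F.coef (vert pt t).pt)).map fun F => labels F.verts)
      rw [List.flatMap_map, ← removedRidges_keys] at this
      have := EvenCount.of_perm (hperm.flatMap_right faceKeys).symm this
      rw [List.flatMap_append, List.flatMap_append] at this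
      exact this.of_append (.double _)
    have h1 : EvenCount (H ++ (Fs.filter fun F => !decide (0 < aff F.coef (vert pt t).pt)).flatMap
        fun F => faceKeys (labels F.verts)) := by
      have hsplit := (List.filter_append_perm (fun F => decide (0 < aff F.coef (vert pt t).pt))
        Fs).flatMap_right (fun F => faceKeys (labels F.verts))
      have := EvenCount.of_perm hsplit h.cycle
      rw [List.flatMap_append, ← removedRidges_keys] at this
      refine EvenCount.of_append (EvenCount.of_perm ?_ this) (.double D)
      refine List.Perm.trans ?_ (hperm.symm.append_right _)
      rw [List.append_assoc, List.append_assoc]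
      exact List.perm_append_comm.append_left _
    rw [List.flatMap_append, ← List.flatMap_map (f := fun F : Facet n ℝ => labels F.verts)
      (g := faceKeys) (l := List.map _ _), hkeys, List.flatMap_map]
    have h3 := (h2.map (f := (t :: ·)) fun a b hab => (List.cons.inj hab).2).append h1
    refine .of_perm ?_ h3
    rw [← List.append_assoc]
    refine List.Perm.append_right _ ?_
    refine (flatMap_cons_perm H (fun a => a) fun a => (faceKeys a).map (t :: ·)).trans ?_
    rw [List.map_id', ← List.map_flatMap]
    exact List.perm_append_comm

/-! ### The number of steps -/

theorem exists_mkFacetT_cost_le (n : ℕ) : ∃ A : ℕ, ∀ (vs : List (Vertex n ℝ)) (opp : Vertex n ℝ),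
    (mkFacetT vs opp).cost ≤ A := by
  obtain ⟨c, hc⟩ := exists_detT_cost_le n
  refine ⟨n * (n + 1) + ((n * n + c + 2) * (n + 1) + 1) + (4 * (n + 1) + 1) + 1 +
    (2 * (n + 1) + 2), fun vs opp => ?_⟩
  have h1 : ∀ X : Matrix (Fin n) (Fin (n + 1)) ℝ, (arrayT (n + 1) fun j => do
      charge (n * n)
      let d ← detT n (X.submatrix id j.succAbove)
      signedT j d).cost ≤ (n * n + c + 2) * (n + 1) + 1 := fun X => by
    refine arrayT_cost_le _ _ (c := n * n + c + 1) fun j => ?_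
    simp only [cost_bind, cost_charge, signedT_cost]
    have := hc ℝ (X.submatrix id j.succAbove)
    omega
  simp only [mkFacetT, cost_bind, cost_charge, cost_prim, val_prim]
  have h2 := fun c : Fin (n + 1) → ℝ => evalT_cost_le c opp.pt
  have h3 : ∀ (b : Bool) (x : Timed (Facet n ℝ)) (y : Timed (Facet n ℝ)),
      x.cost ≤ 2 * (n + 1) + 2 → y.cost ≤ 2 * (n + 1) + 2 →
        (if b then x else y).cost ≤ 2 * (n + 1) + 2 := by
    intro b x y hx hy
    cases b <;> simpa
  simp only [← add_assoc]
  refine (Nat.add_le_add (Nat.add_le_add_right (Nat.add_le_add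
    (Nat.add_le_add_left (h1 _) _) (h2 _)) 1) (h3 _ _ _ ?_ ?_)).trans (by omega)
  · simp only [cost_bind, cost_prim]
    exact Nat.add_le_add_right ((arrayT_cost_le _ _ (c := 1) fun _ => le_rfl).trans (by omega)) 1
  · simp only [cost_prim]
    omega

theorem length_labels (vs : List (Vertex n ℝ)) : (labels vs).length = vs.length := by
  simp [labels]

/-- Every removed facet has n ridges, so all lists handled have length at most n times that of `Fs`.
Only sorting contributes the logarithmic factor D; everything else is linear. -/
theorem exists_stepT_cost_le (n : ℕ) : ∃ A : ℕ, ∀ (pt : ℕ → Fin n → ℝ) (m t D : ℕ)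
    (Fs : List (Facet n ℝ)), Invariant pt m t Fs → n * Fs.length ≤ 2 ^ D →
      (stepT Fs (vert pt t)).cost ≤ A * ((Fs.length + 1) * (D + 1)) := by
  obtain ⟨M, hM⟩ := exists_mkFacetT_cost_le n
  refine ⟨(4 * (n + 1) + 3) + ((2 * n + 2) * (n + 1) + n + 1) + n * (1 + (3 * n + 6) + (6 * n + 4)
    + (M + 2)) + 7, fun pt m t D Fs h hD => ?_⟩
  set R := Fs.filter fun F => decide (0 < aff F.coef (vert pt t).pt) with hR
  set L := removedRidges Fs (vert pt t) with hL
  have hRF : R.length ≤ Fs.length := List.length_filter_le _ _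
  have hRmem : ∀ F ∈ R, F.verts.length = n := fun F hF => by
    rw [← length_labels]
    exact (h.isFacet F (List.mem_filter.mp hF).1).length_eq
  have hLlen : L.length = n * R.length := by
    rw [hL, removedRidges, List.length_flatMap, ← hR,
      List.map_congr_left (g := fun _ => n) fun F hF => by rw [ridgesT_length, hRmem F hF]]
    simp [mul_comm]
  have hLF : L.length ≤ n * Fs.length := hLlen ▸ Nat.mul_le_mul_left n hRF
  have hLmem : ∀ r ∈ L, r.verts.length ≤ n := fun r hr => by
    obtain ⟨F, hF, hrF⟩ := List.mem_flatMap.mp hr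
    exact (ridgesT_perm hrF).2.length_le.trans (hRmem F hF).le
  have hS := sortT_perm ridgeLeT L
  have hHlen : (horizon Fs (vert pt t)).length ≤ n * Fs.length :=
    ((cancelPairsT_sublist _).length_le.trans hS.length_eq.le).trans hLF
  have e1 : (partitionT (beyondT (vert pt t).pt) Fs).val =
      (R, Fs.filter fun F => !decide (0 < aff F.coef (vert pt t).pt)) := by
    simp only [partitionT_val, beyondT_val, hR]
  have e2 : (flatMapT (fun F : Facet n ℝ => ridgesT F.verts) R).val = L := flatMapT_val _ _
  have e3 : (cancelPairsT (sortT ridgeLeT L).val).val = horizon Fs (vert pt t) := rfl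
  have c1 := partitionT_cost_le (beyondT (vert pt t).pt) (l := Fs) (c := 4 * (n + 1) + 2)
    fun F _ => by
      have := evalT_cost_le F.coef (vert pt t).pt
      simp only [beyondT, cost_bind, cost_prim]
      omega
  have c2 := flatMapT_cost_le (fun F : Facet n ℝ => ridgesT F.verts) (l := R)
    (c := (2 * n + 2) * (n + 1)) (k := n)
    (fun F hF => by have := ridgesT_cost_le F.verts; rwa [hRmem F hF] at this)
    (fun F hF => by rw [ridgesT_length, hRmem F hF])
  have c3 := sortT_cost_le ridgeLeT D L (c := 3 * n + 1)
    (fun r hr s _ => (lexLeT_cost_le _ _).trans (by have := hLmem r hr; omega)) (hLF.trans hD)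
  have c4 := cancelPairsT_cost_le (k := n) (sortT ridgeLeT L).val
    fun r hr => hLmem r (hS.subset hr)
  rw [hS.length_eq] at c4
  have c5 := mapT_cost_le (fun r => mkFacetT (vert pt t :: r.verts) r.opp)
    (l := horizon Fs (vert pt t)) (c := M) fun r _ => hM _ _
  simp only [stepT, cost_bind, e1, e2, e3, appendT_cost, mapT_val, List.length_map]
  generalize (partitionT (beyondT (vert pt t).pt) Fs).cost = x1 at *
  generalize (flatMapT (fun F : Facet n ℝ => ridgesT F.verts) R).cost = x2 at *
  generalize (sortT ridgeLeT L).cost = x3 at *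
  generalize (cancelPairsT (sortT ridgeLeT L).val).cost = x4 at *
  generalize (mapT (fun r => mkFacetT (vert pt t :: r.verts) r.opp)
    (horizon Fs (vert pt t))).cost = x5 at *
  generalize (horizon Fs (vert pt t)).length = H at *
  generalize Fs.length = N at *
  generalize R.length = r at *
  generalize L.length = l at *
  have c2' : x2 ≤ ((2 * n + 2) * (n + 1) + n + 1) * N + 1 :=
    c2.trans (Nat.add_le_add_right (Nat.mul_le_mul_left _ hRF) 1)
  have c3' : x3 ≤ n * N + 1 + ((3 * n + 6) * (n * N) * D + 1) := by
    refine c3.trans (Nat.add_le_add (Nat.add_le_add_right hLF 1) (Nat.add_le_add_right ?_ 1))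
    exact Nat.mul_le_mul_right _ (Nat.mul_le_mul_left _ hLF)
  have c4' : x4 ≤ (6 * n + 4) * (n * N) + 1 :=
    c4.trans (Nat.add_le_add_right (Nat.mul_le_mul_left _ hLF) 1)
  have c5' : x5 ≤ (M + 1) * (n * N) + 1 :=
    c5.trans (Nat.add_le_add_right (Nat.mul_le_mul_left _ hHlen) 1)
  have total : x1 + (x2 + (x3 + (x4 + (x5 + (H + 1))))) ≤
      ((4 * (n + 1) + 3) + ((2 * n + 2) * (n + 1) + n + 1) + n * (1 + (6 * n + 4) + (M + 2))) * N
        + n * (3 * n + 6) * (N * D) + 7 := by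
    linarith
  refine total.trans ?_
  have : ∀ a b N D : ℕ, a * N + b * (N * D) + 7 ≤ (a + b + 7) * ((N + 1) * (D + 1)) := by
    intro a b N D
    have h1 : N ≤ (N + 1) * (D + 1) := by nlinarith
    have h2 : N * D ≤ (N + 1) * (D + 1) := by nlinarith
    have h3 : 1 ≤ (N + 1) * (D + 1) := Nat.mul_pos (by omega) (by omega)
    nlinarith [Nat.mul_le_mul_left a h1, Nat.mul_le_mul_left b h2]
  refine (this _ _ N D).trans (le_of_eq ?_)
  ring

/-- The bounds `N t` are demanded for every list that satisfies the invariant, so the probabilistic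
part need not know which lists the algorithm produces. -/
theorem insertAllT_cost_le {A D m : ℕ} {pt : ℕ → Fin n → ℝ} {N : ℕ → ℕ}
    (hA : ∀ (t : ℕ) (Fs : List (Facet n ℝ)), Invariant pt m t Fs → n * Fs.length ≤ 2 ^ D →
      (stepT Fs (vert pt t)).cost ≤ A * ((Fs.length + 1) * (D + 1)))
    (hgp : GeneralPosition pt m)
    (hN : ∀ (t : ℕ) (Fs : List (Facet n ℝ)), t ≤ m → Invariant pt m t Fs →
      Fs.length ≤ N t ∧ n * Fs.length ≤ 2 ^ D)
    (k t : ℕ) (htk : t + k ≤ m + 1) (Fs : List (Facet n ℝ)) (h : Invariant pt m t Fs) :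
    (insertAllT Fs t ((List.range' t k).map pt)).cost ≤
      ∑ s ∈ Finset.Ico t (t + k), (A * ((N s + 1) * (D + 1)) + 1) + 1 := by
  induction k generalizing t Fs with
  | zero => simp [insertAllT]
  | succ k ih =>
    have h1 := ih (t + 1) (by omega) _ (h.stepT hgp (by omega))
    obtain ⟨hN1, hN2⟩ := hN t Fs (by omega) h
    have h2 := (hA t Fs h hN2).trans
      (Nat.mul_le_mul_left A (Nat.mul_le_mul_right _ (Nat.add_le_add_right hN1 1)))
    rw [Finset.sum_eq_sum_Ico_succ_bot (by omega)]
    simp only [List.range'_succ, List.map_cons, insertAllT, cost_bind, cost_prim, val_prim]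
    rw [show t + 1 + k = t + (k + 1) by omega] at h1
    have e : stepT Fs ⟨t, pt t⟩ = stepT Fs (vert pt t) := rfl
    rw [e]
    omega

theorem simplexT_cost_le {M : ℕ} (hM : ∀ (vs : List (Vertex n ℝ)) (opp : Vertex n ℝ),
    (mkFacetT vs opp).cost ≤ M) (vs : List (Vertex n ℝ)) :
    (simplexT vs).cost ≤ (2 * vs.length + 2) * (vs.length + 1) + ((M + 1) * vs.length + 1) := by
  have h1 := ridgesT_cost_le vs
  have h2 := mapT_cost_le (fun r : Ridge n ℝ => mkFacetT r.verts r.opp) (l := (ridgesT vs).val)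
    (c := M) fun r _ => hM _ _
  rw [ridgesT_length] at h2
  simp only [simplexT, cost_bind]
  omega

theorem startT_cost_le {A D m B : ℕ} {pt : ℕ → Fin n → ℝ} {N : ℕ → ℕ}
    (hA : ∀ (t : ℕ) (Fs : List (Facet n ℝ)), Invariant pt m t Fs → n * Fs.length ≤ 2 ^ D →
      (stepT Fs (vert pt t)).cost ≤ A * ((Fs.length + 1) * (D + 1)))
    (hgp : GeneralPosition pt m)
    (hN : ∀ (t : ℕ) (Fs : List (Facet n ℝ)), t ≤ m → Invariant pt m t Fs →
      Fs.length ≤ N t ∧ n * Fs.length ≤ 2 ^ D)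
    (hB : ∀ vs : List (Vertex n ℝ), vs.length = n + 1 → (simplexT vs).cost ≤ B)
    (d t k : ℕ) (hd : d + t = n + 1) (hk : t + k = m + 1) (l : List ℕ) (hl : l.length = t)
    (hp : l.Pairwise (· > ·)) (hlt : ∀ i, i < t ↔ i ∈ l) :
    (startT d t (l.map (vert pt)) ((List.range' t k).map pt)).cost ≤
      2 * d + B + ∑ s ∈ Finset.Icc n m, (A * ((N s + 1) * (D + 1)) + 1) + 1 := by
  induction d generalizing t k l with
  | zero =>
    have h1 := hB (l.map (vert pt)) (by rw [List.length_map]; omega)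
    have h2 := invariant_simplexT hgp (by omega) hp (by omega) hlt
    have h3 := insertAllT_cost_le hA hgp hN k t (by omega) _ h2
    -- Label 0 belongs to the origin, so the first inserted label is t = n + 1; the sum is merely
    -- enlarged by the term s = n.
    have h4 : ∑ s ∈ Finset.Ico t (t + k), (A * ((N s + 1) * (D + 1)) + 1) ≤
        ∑ s ∈ Finset.Icc n m, (A * ((N s + 1) * (D + 1)) + 1) :=
      Finset.sum_le_sum_of_subset fun s hs => by
        rw [Finset.mem_Ico] at hs
        rw [Finset.mem_Icc]
        omega
    simp only [startT, cost_bind]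
    omega
  | succ d ih =>
    cases k with
    | zero =>
      simp only [List.range'_zero, List.map_nil, startT, cost_prim]
      omega
    | succ k =>
      have := ih (t + 1) k (by omega) (by omega) (t :: l) (by simp [hl])
        (List.pairwise_cons.mpr ⟨fun i hi => (hlt i).mpr hi, hp⟩)
        (fun i => by rw [List.mem_cons, ← hlt]; omega)
      simp only [List.range'_succ, List.map_cons, startT, cost_bind, cost_prim, val_prim] at this ⊢
      have e : (⟨t, pt t⟩ : Vertex n ℝ) = vert pt t := rfl
      rw [e]
      omega

/-- The points of the input in their order, preceded by the origin. -/
noncomputable def inputPoint {m : ℕ} (a : Fin m → Metric.sphere (0 : EuclideanSpace ℝ (Fin n)) 1) :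
    ℕ → Fin n → ℝ
  | 0 => 0
  | i + 1 => if h : i < m then fun j => (a ⟨i, h⟩ : EuclideanSpace ℝ (Fin n)) j else 0

theorem ofFn_eq_map_inputPoint {m : ℕ}
    (a : Fin m → Metric.sphere (0 : EuclideanSpace ℝ (Fin n)) 1) :
    (List.ofFn fun i => (fun j => (a i : EuclideanSpace ℝ (Fin n)) j)) =
      (List.range' 1 m).map (inputPoint a) := by
  refine List.ext_getElem (by simp) fun i h1 h2 => ?_
  have hi : i < m := by simpa using h1
  simp [add_comm 1 i, inputPoint, hi]

/-- The running time is controlled by upper bounds `N t` for the numbers of facets. -/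
theorem exists_runningTime_le (n : ℕ) : ∃ A : ℕ, ∀ (m D : ℕ)
    (a : Fin m → Metric.sphere (0 : EuclideanSpace ℝ (Fin n)) 1) (N : ℕ → ℕ),
    GeneralPosition (inputPoint a) m →
    (∀ (t : ℕ) (Fs : List (Facet n ℝ)), t ≤ m → Invariant (inputPoint a) m t Fs →
      Fs.length ≤ N t ∧ n * Fs.length ≤ 2 ^ D) →
    runningTime a ≤ A + ∑ s ∈ Finset.Icc n m, A * ((N s + 1) * (D + 1)) := by
  obtain ⟨M, hM⟩ := exists_mkFacetT_cost_le n
  obtain ⟨A, hA⟩ := exists_stepT_cost_le n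
  refine ⟨2 * n + ((2 * (n + 1) + 2) * (n + 1 + 1) + ((M + 1) * (n + 1) + 1)) + 1 + A,
    fun m D a N hgp hN => ?_⟩
  have h := startT_cost_le (fun t Fs => hA (inputPoint a) m t D Fs) hgp hN
    (fun vs hvs => hvs ▸ simplexT_cost_le hM vs) n 1 m rfl (add_comm _ _) [0] rfl (by simp)
    (by simp)
  have e : (List.map (vert (inputPoint a)) [0]) = [⟨0, 0⟩] := rfl
  rw [e] at h
  rw [runningTime, beneathBeyond, ofFn_eq_map_inputPoint]
  refine h.trans ?_
  generalize 2 * n + ((2 * (n + 1) + 2) * (n + 1 + 1) + ((M + 1) * (n + 1) + 1)) = B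
  have : ∑ s ∈ Finset.Icc n m, (A * ((N s + 1) * (D + 1)) + 1) ≤
      ∑ s ∈ Finset.Icc n m, (B + 1 + A) * ((N s + 1) * (D + 1)) := by
    refine Finset.sum_le_sum fun s _ => ?_
    have : 0 < (N s + 1) * (D + 1) := by positivity
    nlinarith [Nat.zero_le (B * ((N s + 1) * (D + 1)))]
  omega

open Metric
open scoped Pointwise

/-! ### The uniform measure on the sphere -/

theorem isProbabilityMeasure_sphereUniform {n : ℕ} (hn : n ≠ 0) :
    IsProbabilityMeasure (sphereUniform n) := by
  have : Nonempty (Fin n) := ⟨⟨0, Nat.pos_of_ne_zero hn⟩⟩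
  have : NeZero (volume : Measure (EuclideanSpace ℝ (Fin n))).toSphere :=
    ⟨Measure.toSphere_ne_zero _⟩
  exact ⟨by
    rw [sphereUniform, Measure.smul_apply, smul_eq_mul]
    exact ENNReal.inv_mul_cancel (Measure.measure_univ_ne_zero.mpr (NeZero.ne _))
      (measure_ne_top _ _)⟩

section Cone

/-- The open cone of height one over a subset of the sphere. -/
def cone (s : Set (sphere (0 : EuclideanSpace ℝ (Fin n)) 1)) : Set (EuclideanSpace ℝ (Fin n)) :=
  Set.Ioo (0 : ℝ) 1 • ((↑) '' s : Set (EuclideanSpace ℝ (Fin n)))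

theorem mem_cone {s : Set (sphere (0 : EuclideanSpace ℝ (Fin n)) 1)}
    {w : EuclideanSpace ℝ (Fin n)} :
    w ∈ cone s ↔ ∃ r : ℝ, 0 < r ∧ r < 1 ∧ ∃ y ∈ s, w = r • (y : EuclideanSpace ℝ (Fin n)) := by
  simp only [cone, Set.mem_smul, Set.mem_Ioo, Set.mem_image]
  constructor
  · rintro ⟨r, hr, _, ⟨y, hy, rfl⟩, rfl⟩
    exact ⟨r, hr.1, hr.2, y, hy, rfl⟩
  · rintro ⟨r, h0, h1, y, hy, rfl⟩
    exact ⟨r, ⟨h0, h1⟩, _, ⟨y, hy, rfl⟩, rfl⟩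

theorem norm_sphere (y : sphere (0 : EuclideanSpace ℝ (Fin n)) 1) :
    ‖(y : EuclideanSpace ℝ (Fin n))‖ = 1 := by
  simp

theorem cone_subset_ball (s : Set (sphere (0 : EuclideanSpace ℝ (Fin n)) 1)) :
    cone s ⊆ ball 0 1 := by
  intro w hw
  obtain ⟨r, h0, h1, y, -, rfl⟩ := mem_cone.mp hw
  rw [mem_ball_zero_iff, norm_smul, norm_sphere, mul_one, Real.norm_of_nonneg h0.le]
  exact h1

/-- The measure `toSphere` is n times the volume of the cone, and the factor n cancels in the
normalisation. -/
theorem sphereUniform_real_apply (hn : n ≠ 0) {s : Set (sphere (0 : EuclideanSpace ℝ (Fin n)) 1)}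
    (hs : MeasurableSet s) : (sphereUniform n).real s =
      volume.real (cone s) / volume.real (ball (0 : EuclideanSpace ℝ (Fin n)) 1) := by
  have hn' : (n : ℝ) ≠ 0 := Nat.cast_ne_zero.mpr hn
  have h1 : (volume : Measure (EuclideanSpace ℝ (Fin n))).toSphere.real s =
      n * volume.real (cone s) := by
    rw [measureReal_def, Measure.toSphere_apply' _ hs, ENNReal.toReal_mul]
    simp [measureReal_def, cone]
  rw [sphereUniform, measureReal_ennreal_smul_apply, ENNReal.toReal_inv, ← measureReal_def, h1,
    Measure.toSphere_real_apply_univ, finrank_euclideanSpace_fin]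
  field_simp

theorem volume_real_ball_pos : 0 < volume.real (ball (0 : EuclideanSpace ℝ (Fin n)) 1) :=
  ENNReal.toReal_pos (measure_ball_pos _ _ one_pos).ne' measure_ball_lt_top.ne

/-- Caps of radius `ρ` have measure of the order `ρ ^ (n - 1)`. -/
theorem sphereUniform_real_ball (hn : n ≠ 0) (u : sphere (0 : EuclideanSpace ℝ (Fin n)) 1)
    {ρ : ℝ} (h0 : 0 < ρ) (h1 : ρ ≤ 1) :
    2 / (16 ^ n * n) * ρ ^ (n - 1) ≤ (sphereUniform n).real (ball u ρ) ∧
      (sphereUniform n).real (ball u ρ) ≤ 2 ^ (n + 1) * ρ ^ (n - 1) := by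
  have : Nonempty (Fin n) := ⟨⟨0, Nat.pos_of_ne_zero hn⟩⟩
  have hnpos : (0 : ℝ) < n := Nat.cast_pos.mpr (Nat.pos_of_ne_zero hn)
  set ω := volume.real (ball (0 : EuclideanSpace ℝ (Fin n)) 1) with hω
  have hωpos : 0 < ω := volume_real_ball_pos
  rw [sphereUniform_real_apply hn measurableSet_ball]
  set A := cone (ball u ρ) with hA
  set V := volume.real A with hV
  -- The shell A \ c • A of thickness ρ/2 has volume (1 - c^n) V. It lies in a ball of radius 2ρ
  -- about u and contains the ball of radius ρ/16 about (1 - ρ/4) u, in the middle of the shell; as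
  -- 1 - c^n is between ρ/2 and nρ/2, this determines V up to constants.
  set c : ℝ := 1 - ρ / 2 with hc
  have hc0 : 0 < c := by rw [hc]; linarith
  have hc1 : c < 1 := by rw [hc]; linarith
  have hAo : IsOpen A := isOpen_Ioo.smul_sphere one_ne_zero (by simp) isOpen_ball
  have hAfin : volume A ≠ ⊤ := ((measure_mono (cone_subset_ball _)).trans_lt measure_ball_lt_top).ne
  have hsub : c • A ⊆ A := by
    rintro _ ⟨w, hw, rfl⟩
    obtain ⟨r, hr0, hr1, y, hy, rfl⟩ := mem_cone.mp hw
    exact mem_cone.mpr ⟨c * r, mul_pos hc0 hr0, by nlinarith, y, hy, smul_smul _ _ _⟩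
  have hdiff : volume.real (A \ c • A) = (1 - c ^ n) * V := by
    rw [measureReal_sdiff hsub (hAo.smul₀ hc0.ne').measurableSet, measureReal_def volume (c • A),
      Measure.addHaar_smul, finrank_euclideanSpace_fin, ENNReal.toReal_mul,
      abs_of_pos (by positivity), ENNReal.toReal_ofReal (by positivity), ← measureReal_def]
    ring
  have hball : ∀ (x : EuclideanSpace ℝ (Fin n)) {r : ℝ}, 0 ≤ r →
      volume.real (closedBall x r) = r ^ n * ω := fun x r hr => by
    rw [Measure.addHaar_real_closedBall _ _ hr, finrank_euclideanSpace_fin]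
  have hpow : ρ ^ n = ρ ^ (n - 1) * ρ := by
    rw [← pow_succ, Nat.sub_add_cancel (Nat.pos_of_ne_zero hn)]
  have hup : (1 - c ^ n) * V ≤ (2 * ρ) ^ n * ω := by
    rw [← hdiff, ← hball (u : EuclideanSpace ℝ (Fin n)) (by positivity)]
    refine measureReal_mono (fun w hw => ?_) measure_closedBall_lt_top.ne
    obtain ⟨r, hr0, hr1, y, hy, rfl⟩ := mem_cone.mp hw.1
    have hrc : c ≤ r := by
      by_contra! hlt
      refine hw.2 ⟨(r / c) • (y : EuclideanSpace ℝ (Fin n)),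
        mem_cone.mpr ⟨r / c, by positivity, (div_lt_one hc0).mpr hlt, y, hy, rfl⟩, ?_⟩
      simp only [smul_smul]
      rw [mul_div_cancel₀ _ hc0.ne']
    have h2 : dist (y : EuclideanSpace ℝ (Fin n)) u < ρ := hy
    have h3 : dist (r • (y : EuclideanSpace ℝ (Fin n))) y = 1 - r := by
      rw [dist_eq_norm, show r • (y : EuclideanSpace ℝ (Fin n)) - y =
        (r - 1) • (y : EuclideanSpace ℝ (Fin n)) by rw [sub_smul, one_smul], norm_smul, norm_sphere,
        Real.norm_of_nonpos (by linarith)]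
      ring
    have := dist_triangle (r • (y : EuclideanSpace ℝ (Fin n))) y u
    rw [mem_closedBall]
    linarith
  have hlow : (ρ / 16) ^ n * ω ≤ (1 - c ^ n) * V := by
    rw [← hdiff, ← hball ((1 - ρ / 4) • (u : EuclideanSpace ℝ (Fin n))) (by positivity)]
    refine measureReal_mono (fun w hw => ?_)
      (ne_top_of_le_ne_top hAfin (measure_mono Set.sdiff_subset))
    rw [mem_closedBall, dist_eq_norm] at hw
    have hu : ‖(1 - ρ / 4) • (u : EuclideanSpace ℝ (Fin n))‖ = 1 - ρ / 4 := by
      rw [norm_smul, norm_sphere, mul_one, Real.norm_of_nonneg (by linarith)]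
    have hw1 := norm_le_norm_add_norm_sub' w ((1 - ρ / 4) • (u : EuclideanSpace ℝ (Fin n)))
    have hw2 := norm_le_norm_add_norm_sub' ((1 - ρ / 4) • (u : EuclideanSpace ℝ (Fin n))) w
    rw [norm_sub_rev] at hw2
    have hwpos : 0 < ‖w‖ := by linarith
    have hy : ‖w‖⁻¹ • w ∈ sphere (0 : EuclideanSpace ℝ (Fin n)) 1 := by
      rw [mem_sphere_zero_iff_norm, norm_smul, norm_inv, norm_norm, inv_mul_cancel₀ hwpos.ne']
    have hwy : w = ‖w‖ • (‖w‖⁻¹ • w) := by rw [smul_smul, mul_inv_cancel₀ hwpos.ne', one_smul]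
    refine ⟨mem_cone.mpr ⟨‖w‖, hwpos, by linarith, ⟨_, hy⟩, ?_, hwy⟩, ?_⟩
    · have e1 : ‖‖w‖⁻¹ • w - w‖ = 1 - ‖w‖ := by
        have hpos : 1 ≤ ‖w‖⁻¹ := (one_le_inv₀ hwpos).mpr (by linarith)
        rw [show ‖w‖⁻¹ • w - w = (‖w‖⁻¹ - 1) • w by module, norm_smul,
          Real.norm_of_nonneg (by linarith), sub_mul, one_mul, inv_mul_cancel₀ hwpos.ne']
      have e2 : ‖(1 - ρ / 4) • (u : EuclideanSpace ℝ (Fin n)) - u‖ = ρ / 4 := by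
        rw [show (1 - ρ / 4) • (u : EuclideanSpace ℝ (Fin n)) - u =
          (-(ρ / 4)) • (u : EuclideanSpace ℝ (Fin n)) by module, norm_smul, norm_sphere,
          Real.norm_of_nonpos (by linarith)]
        ring
      have e3 : ‖‖w‖⁻¹ • w - u‖ ≤ ‖‖w‖⁻¹ • w - w‖ +
          ‖w - (1 - ρ / 4) • (u : EuclideanSpace ℝ (Fin n))‖ +
          ‖(1 - ρ / 4) • (u : EuclideanSpace ℝ (Fin n)) - u‖ := by
        refine (le_of_eq ?_).trans norm_add₃_le
        congr 1
        abel
      have : dist (‖w‖⁻¹ • w) (u : EuclideanSpace ℝ (Fin n)) < ρ := by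
        rw [dist_eq_norm]
        linarith
      exact this
    · rintro ⟨z, hz, hzw⟩
      obtain ⟨r, hr0, hr1, y, -, rfl⟩ := mem_cone.mp hz
      have : ‖w‖ = c * r := by
        rw [← hzw, norm_smul, norm_smul, norm_sphere, mul_one, Real.norm_of_nonneg hc0.le,
          Real.norm_of_nonneg hr0.le]
      nlinarith
  have hV0 : 0 ≤ V := measureReal_nonneg
  have hb1 : ρ / 2 ≤ 1 - c ^ n := by
    have := pow_le_of_le_one hc0.le hc1.le hn
    linarith
  have hb2 : 1 - c ^ n ≤ n * (ρ / 2) := by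
    have := one_add_mul_le_pow (a := -(ρ / 2)) (by linarith) n
    rw [hc, sub_eq_add_neg 1 (ρ / 2)]
    linarith
  rw [le_div_iff₀ hωpos, div_le_iff₀ hωpos]
  constructor
  · have h3 : (ρ / 16) ^ n * ω ≤ n * (ρ / 2) * V :=
      hlow.trans (mul_le_mul_of_nonneg_right hb2 hV0)
    rw [div_pow, hpow] at h3
    have h4 : ρ ^ (n - 1) / 16 ^ n * ω ≤ n / 2 * V := by
      refine le_of_mul_le_mul_left ?_ h0
      calc ρ * (ρ ^ (n - 1) / 16 ^ n * ω) = ρ ^ (n - 1) * ρ / 16 ^ n * ω := by ring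
        _ ≤ n * (ρ / 2) * V := h3
        _ = ρ * (n / 2 * V) := by ring
    calc 2 / (16 ^ n * n) * ρ ^ (n - 1) * ω = 2 / n * (ρ ^ (n - 1) / 16 ^ n * ω) := by
          field_simp
      _ ≤ 2 / n * (n / 2 * V) := mul_le_mul_of_nonneg_left h4 (by positivity)
      _ = V := by field_simp
  · have h3 : ρ / 2 * V ≤ (2 * ρ) ^ n * ω := (mul_le_mul_of_nonneg_right hb1 hV0).trans hup
    rw [mul_pow, hpow] at h3
    rw [pow_succ]
    nlinarith

/-- Spheres of smaller dimension have measure zero. -/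
theorem sphereUniform_inner_eq (hn : 2 ≤ n) {u : EuclideanSpace ℝ (Fin n)} (hu : u ≠ 0) (b : ℝ) :
    sphereUniform n {x | inner ℝ u (x : EuclideanSpace ℝ (Fin n)) = b} = 0 := by
  wlog hb : 0 ≤ b generalizing u b
  · have := this (neg_ne_zero.mpr hu) (-b) (by linarith)
    simpa only [inner_neg_left, neg_inj] using this
  have := isProbabilityMeasure_sphereUniform (n := n) (by omega)
  have hmeas : MeasurableSet {x : sphere (0 : EuclideanSpace ℝ (Fin n)) 1 |
      inner ℝ u (x : EuclideanSpace ℝ (Fin n)) = b} :=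
    (isClosed_eq (by fun_prop) (by fun_prop)).measurableSet
  rw [← measureReal_eq_zero_iff, sphereUniform_real_apply (by omega) hmeas]
  suffices h : volume (cone {x : sphere (0 : EuclideanSpace ℝ (Fin n)) 1 |
      inner ℝ u (x : EuclideanSpace ℝ (Fin n)) = b}) = 0 by
    rw [measureReal_def, h]
    simp
  -- For b ≥ 0 this set is convex, so its frontier is null. A point of equality in its interior
  -- stays in Q when moved by -εu, which forces ‖u‖ ≤ b and equality in Cauchy–Schwarz; it then lies
  -- on the line through u, null because n ≥ 2.
  set Q : Set (EuclideanSpace ℝ (Fin n)) := {w | b * ‖w‖ - inner ℝ u w ≤ 0} with hQ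
  have hconv : Convex ℝ Q := by
    have h1 : ConvexOn ℝ Set.univ fun w : EuclideanSpace ℝ (Fin n) => b * ‖w‖ - inner ℝ u w := by
      refine ConvexOn.sub ((convexOn_norm convex_univ).smul hb) ?_
      exact (innerₗ (EuclideanSpace ℝ (Fin n)) u).concaveOn convex_univ
    simpa [hQ] using h1.convex_le 0
  have hspan : (ℝ ∙ u) ≠ ⊤ := fun h => by
    have h1 := finrank_span_singleton (K := ℝ) hu
    rw [h, finrank_top, finrank_euclideanSpace_fin] at h1
    omega
  refine measure_mono_null ?_ (measure_union_null (hconv.addHaar_frontier volume)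
    (Measure.addHaar_submodule volume (ℝ ∙ u) hspan))
  intro w hw
  obtain ⟨r, hr0, hr1, y, hy, rfl⟩ := mem_cone.mp hw
  set w := r • (y : EuclideanSpace ℝ (Fin n)) with hwdef
  have hwin : inner ℝ u w = b * ‖w‖ := by
    rw [hwdef, inner_smul_right, norm_smul, norm_sphere, mul_one, Real.norm_of_nonneg hr0.le,
      Set.mem_ofPred_eq.mp hy, mul_comm]
  clear_value w
  by_cases hint : w ∈ interior Q
  · right
    have hupos : 0 < ‖u‖ := norm_pos_iff.mpr hu
    have hcont : Filter.Tendsto (fun ε : ℝ => w - ε • u) (nhdsWithin 0 (Set.Ioi 0)) (nhds w) := by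
      have : Continuous fun ε : ℝ => w - ε • u := by fun_prop
      simpa using (this.tendsto 0).mono_left nhdsWithin_le_nhds
    obtain ⟨ε, hεQ, hε⟩ := ((hcont.eventually (mem_interior_iff_mem_nhds.mp hint)).and
      self_mem_nhdsWithin).exists
    have hε : 0 < ε := hε
    have h1 : b * ‖w - ε • u‖ - inner ℝ u (w - ε • u) ≤ 0 := hεQ
    rw [inner_sub_right, inner_smul_right, real_inner_self_eq_norm_sq, hwin] at h1
    have h2 : ‖w‖ - ε * ‖u‖ ≤ ‖w - ε • u‖ := by
      have := norm_sub_norm_le w (ε • u)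
      rwa [norm_smul, Real.norm_of_nonneg hε.le] at this
    have h3 : ‖u‖ ≤ b := by
      have h4 := mul_le_mul_of_nonneg_left h2 hb
      have h5 : ε * ‖u‖ * ‖u‖ ≤ ε * ‖u‖ * b := by nlinarith
      exact le_of_mul_le_mul_left h5 (by positivity)
    have h4 : inner ℝ u w = ‖u‖ * ‖w‖ :=
      le_antisymm (real_inner_le_norm _ _)
        (hwin ▸ mul_le_mul_of_nonneg_right h3 (norm_nonneg _))
    rw [inner_eq_norm_mul_iff_real] at h4
    refine Submodule.mem_span_singleton.mpr ⟨‖u‖⁻¹ * ‖w‖, ?_⟩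
    rw [mul_smul, h4, smul_smul, inv_mul_cancel₀ hupos.ne', one_smul]
  · left
    exact ⟨subset_closure (by rw [hQ, Set.mem_ofPred_eq, hwin, sub_self]), hint⟩

/-- Almost no point of the sphere lies on a given hyperplane. -/
theorem sphereUniform_aff_eq_zero (hn : 2 ≤ n) {c : Fin (n + 1) → ℝ} (hc : c ≠ 0) :
    sphereUniform n {x | aff c (fun j => (x : EuclideanSpace ℝ (Fin n)) j) = 0} = 0 := by
  set u : EuclideanSpace ℝ (Fin n) := WithLp.toLp 2 fun i => c i.succ with hu
  have haff : ∀ x : EuclideanSpace ℝ (Fin n), aff c (fun j => x j) = c 0 + inner ℝ u x := by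
    intro x
    rw [aff_eq, PiLp.inner_apply]
    simp [hu, mul_comm]
  by_cases h : u = 0
  · have h0 : c 0 ≠ 0 := fun h0 => hc <| funext fun j => by
      refine Fin.cases h0 (fun i => ?_) j
      exact congrArg (fun v : EuclideanSpace ℝ (Fin n) => v i) h
    simp [haff, h, h0]
  · have := sphereUniform_inner_eq hn h (-c 0)
    simpa only [haff, add_comm (c 0), add_eq_zero_iff_eq_neg] using this

/-- A finite net of the sphere by caps of radius `ρ`. -/
theorem exists_net (hn : n ≠ 0) {ρ : ℝ} (h0 : 0 < ρ) (h1 : ρ ≤ 1) :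
    ∃ Z : Finset (sphere (0 : EuclideanSpace ℝ (Fin n)) 1),
      (∀ x, ∃ z ∈ Z, dist x z < ρ) ∧
      (Z.card : ℝ) * (2 / (16 ^ n * n) * (ρ / 2) ^ (n - 1)) ≤ 1 := by
  classical
  have := isProbabilityMeasure_sphereUniform hn
  have hnpos : (0 : ℝ) < n := Nat.cast_pos.mpr (Nat.pos_of_ne_zero hn)
  set c : ℝ := 2 / (16 ^ n * n) * (ρ / 2) ^ (n - 1) with hc
  have hcpos : 0 < c := by positivity
  -- A ρ-separated set of maximal size is a net. Its size is bounded because the caps of half the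
  -- radius are disjoint and each has measure at least c.
  let P : ℕ → Prop := fun k => ∃ Z : Finset (sphere (0 : EuclideanSpace ℝ (Fin n)) 1),
    Z.card = k ∧ ∀ x ∈ Z, ∀ y ∈ Z, x ≠ y → ρ ≤ dist x y
  have hcard : ∀ Z : Finset (sphere (0 : EuclideanSpace ℝ (Fin n)) 1),
      (∀ x ∈ Z, ∀ y ∈ Z, x ≠ y → ρ ≤ dist x y) → (Z.card : ℝ) * c ≤ 1 := by
    intro Z hZ
    have hd : (Z : Set (sphere (0 : EuclideanSpace ℝ (Fin n)) 1)).PairwiseDisjoint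
        fun z => ball z (ρ / 2) := fun x hx y hy hxy =>
      ball_disjoint_ball (by have := hZ x hx y hy hxy; linarith)
    calc (Z.card : ℝ) * c = ∑ _z ∈ Z, c := by rw [Finset.sum_const, nsmul_eq_mul]
      _ ≤ ∑ z ∈ Z, (sphereUniform n).real (ball z (ρ / 2)) := Finset.sum_le_sum fun z _ =>
          (sphereUniform_real_ball hn z (by positivity) (by linarith)).1
      _ = (sphereUniform n).real (⋃ z ∈ Z, ball z (ρ / 2)) :=
          (measureReal_biUnion_finset hd fun z _ => measurableSet_ball).symm
      _ ≤ 1 := measureReal_le_one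
  have hb : ∀ k, P k → k ≤ ⌊1 / c⌋₊ := by
    rintro k ⟨Z, rfl, hZ⟩
    exact Nat.le_floor ((le_div_iff₀ hcpos).mpr (hcard Z hZ))
  have hP0 : P 0 := ⟨∅, rfl, by simp⟩
  obtain ⟨Z, hZk, hZ⟩ := Nat.findGreatest_spec (P := P) (Nat.zero_le ⌊1 / c⌋₊) hP0
  refine ⟨Z, fun x => ?_, hcard Z hZ⟩
  by_contra! hx
  have hxZ : x ∉ Z := fun h => by
    have := hx x h
    rw [dist_self] at this
    linarith
  have hP : P (Nat.findGreatest P ⌊1 / c⌋₊ + 1) := by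
    refine ⟨insert x Z, by rw [Finset.card_insert_of_notMem hxZ, hZk], fun a ha b hb hab => ?_⟩
    rcases Finset.mem_insert.mp ha with rfl | ha' <;>
      rcases Finset.mem_insert.mp hb with rfl | hb'
    · exact absurd rfl hab
    · exact hx b hb'
    · rw [dist_comm]
      exact hx a ha'
    · exact hZ a ha' b hb' hab
  have := Nat.le_findGreatest (hb _ hP) hP
  omega

end Cone

/-! ### General position -/

section GeneralPosition

variable {m : ℕ}

/-- The points of the input in homogeneous coordinates. -/
noncomputable def homogeneous (a : Fin m → sphere (0 : EuclideanSpace ℝ (Fin n)) 1) (i : ℕ) :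
    Fin (n + 1) → ℝ :=
  Matrix.vecCons 1 (inputPoint a i)

theorem continuous_homogeneous (i : ℕ) :
    Continuous fun a : Fin m → sphere (0 : EuclideanSpace ℝ (Fin n)) 1 => homogeneous a i := by
  refine continuous_pi fun j => ?_
  refine Fin.cases (by simpa [homogeneous] using continuous_const) (fun j => ?_) j
  cases i with
  | zero => simpa [homogeneous, inputPoint] using continuous_const
  | succ i =>
    by_cases h : i < m
    · simp only [homogeneous, inputPoint, h, dite_true, Matrix.cons_val_succ]
      fun_prop
    · simpa [homogeneous, inputPoint, h] using continuous_const

theorem measurableSet_linearIndepOn_homogeneous (T : Finset ℕ) :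
    MeasurableSet {a : Fin m → sphere (0 : EuclideanSpace ℝ (Fin n)) 1 |
      LinearIndepOn ℝ (homogeneous a) (T : Set ℕ)} := by
  have : Continuous fun (a : Fin m → sphere (0 : EuclideanSpace ℝ (Fin n)) 1)
      (i : (T : Set ℕ)) => homogeneous a i := continuous_pi fun i => continuous_homogeneous i
  exact (isOpen_setOfPred_linearIndependent.preimage this).measurableSet

/-- Almost surely a further point is not in the span of at most `n` points. -/
theorem ae_linearIndepOn_insert (hn : 2 ≤ n) {T : Finset ℕ} (hT : T.card ≤ n) {i : Fin m}
    (hi : (i : ℕ) + 1 ∉ T)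
    (h : ∀ᵐ a ∂randomPoints n m, LinearIndepOn ℝ (homogeneous a) (T : Set ℕ)) :
    ∀ᵐ a ∂randomPoints n m,
      LinearIndepOn ℝ (homogeneous a) ((insert ((i : ℕ) + 1) T : Finset ℕ) : Set ℕ) := by
  have := isProbabilityMeasure_sphereUniform (n := n) (by omega)
  obtain ⟨m, rfl⟩ : ∃ k, m = k + 1 := ⟨m - 1, by have := i.2; omega⟩
  set S := sphere (0 : EuclideanSpace ℝ (Fin n)) 1 with hS
  set B : Set (Fin (m + 1) → S) := {a | LinearIndepOn ℝ (homogeneous a) (T : Set ℕ)} ∩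
    {a | LinearIndepOn ℝ (homogeneous a) ((insert ((i : ℕ) + 1) T : Finset ℕ) : Set ℕ)}ᶜ with hB
  have hBm : MeasurableSet B := (measurableSet_linearIndepOn_homogeneous T).inter
    (measurableSet_linearIndepOn_homogeneous _).compl
  suffices hB0 : randomPoints n (m + 1) B = 0 by
    filter_upwards [h, measure_eq_zero_iff_ae_notMem.mp hB0] with a h1 h2
    by_contra h3
    exact h2 ⟨h1, h3⟩
  have hmp := (measurePreserving_piFinSuccAbove (fun _ : Fin (m + 1) => sphereUniform n) i).symm
  rw [randomPoints, ← hmp.measure_preimage_equiv, Measure.prod_apply_symm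
    ((MeasurableEquiv.measurable _) hBm)]
  refine (lintegral_congr fun y => ?_).trans lintegral_zero
  -- By Fubini the slice over fixed other points y must be null. Points labelled in T do not involve
  -- coordinate i, so any `x0` in the slice determines their span W. It is proper because T has at
  -- most n elements, and a functional vanishing on W gives an affine function that vanishes on the
  -- whole slice.
  by_cases hne : ∃ x0 : S, (i.insertNth x0 y : Fin (m + 1) → S) ∈ B
  swap
  · push Not at hne
    convert measure_empty (μ := sphereUniform n)
    ext x
    exact iff_of_false (hne x) (Set.notMem_empty x)
  obtain ⟨x0, hx0⟩ := hne
  have hsame : ∀ x : S, ∀ j, j ≠ (i : ℕ) + 1 →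
      homogeneous (i.insertNth x y : Fin (m + 1) → S) j =
        homogeneous (i.insertNth x0 y : Fin (m + 1) → S) j := by
    intro x j hj
    cases j with
    | zero => rfl
    | succ j =>
      by_cases hjm : j < m + 1
      · obtain ⟨k, hk⟩ := Fin.exists_succAbove_eq (x := ⟨j, hjm⟩) (y := i) fun h => hj (by
          rw [← h])
        simp only [homogeneous, inputPoint, hjm, dite_true, ← hk, Fin.insertNth_apply_succAbove]
      · simp [homogeneous, inputPoint, hjm]
  set W := Submodule.span ℝ (homogeneous (i.insertNth x0 y : Fin (m + 1) → S) '' (T : Set ℕ))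
    with hW
  have hWtop : W < ⊤ := by
    refine lt_top_iff_ne_top.mpr fun htop => ?_
    classical
    have h1 := finrank_span_finset_le_card (R := ℝ)
      (T.image (homogeneous (i.insertNth x0 y : Fin (m + 1) → S)))
    rw [Set.finrank, Finset.coe_image, ← hW, htop, finrank_top, Module.finrank_fin_fun] at h1
    have := Finset.card_image_le (s := T)
      (f := homogeneous (i.insertNth x0 y : Fin (m + 1) → S))
    omega
  obtain ⟨f, hf0, hf⟩ := Submodule.exists_le_ker_of_lt_top W hWtop
  set c : Fin (n + 1) → ℝ := fun j => f fun k => if j = k then 1 else 0 with hc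
  have hfc : ∀ x : Fin n → ℝ, f (Matrix.vecCons 1 x) = aff c x := fun x => by
    rw [LinearMap.pi_apply_eq_sum_univ, aff]
    exact Finset.sum_congr rfl fun j _ => by rw [smul_eq_mul, mul_comm]
  have hc0 : c ≠ 0 := fun h0 => hf0 <| LinearMap.ext fun w => by
    rw [LinearMap.pi_apply_eq_sum_univ]
    exact Finset.sum_eq_zero fun j _ => by
      rw [show (f fun k => if j = k then 1 else 0) = c j from rfl, h0, Pi.zero_apply, smul_zero]
  refine measure_mono_null (fun x hx => ?_) (sphereUniform_aff_eq_zero hn hc0)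
  have hx : (i.insertNth x y : Fin (m + 1) → S) ∈ B := hx
  obtain ⟨hx1, hx2⟩ := hx
  have hspan : homogeneous (i.insertNth x y : Fin (m + 1) → S) ((i : ℕ) + 1) ∈
      Submodule.span ℝ (homogeneous (i.insertNth x y : Fin (m + 1) → S) '' (T : Set ℕ)) := by
    by_contra hns
    refine hx2 ?_
    simp only [Set.mem_ofPred_eq, Finset.coe_insert]
    exact (linearIndepOn_insert (by simpa using hi)).mpr ⟨hx1, hns⟩
  rw [Set.image_congr fun j hj => hsame x j fun h => hi (h ▸ hj)] at hspan
  have h1 := LinearMap.mem_ker.mp (hf hspan)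
  rw [homogeneous, hfc] at h1
  rw [Set.mem_ofPred_eq]
  simpa only [inputPoint, i.2, dite_true, Fin.eta, Fin.insertNth_apply_same] using h1

/-- The origin is not random and cannot be the point added last, so the induction always removes a
nonzero label. It ends at the empty set or at {0}, whose homogeneous vector is nonzero thanks to its
leading 1. -/
theorem ae_linearIndepOn (hn : 2 ≤ n) (k : ℕ) (T : Finset ℕ) (hk : T.card = k) (hkn : k ≤ n + 1)
    (hTm : ∀ i ∈ T, i ≤ m) :
    ∀ᵐ a ∂randomPoints n m, LinearIndepOn ℝ (homogeneous a) (T : Set ℕ) := by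
  induction k generalizing T with
  | zero =>
    rw [Finset.card_eq_zero.mp hk]
    exact Filter.Eventually.of_forall fun a => by
      rw [Finset.coe_empty]
      exact linearIndepOn_empty _ _
  | succ k ih =>
    by_cases h0 : ∃ i ∈ T, i ≠ 0
    · obtain ⟨i, hi, hi0⟩ := h0
      obtain ⟨j, rfl⟩ := Nat.exists_eq_succ_of_ne_zero hi0
      have hcard : (T.erase (j + 1)).card = k := by
        rw [Finset.card_erase_of_mem hi]
        omega
      have h1 := ih (T.erase (j + 1)) hcard (by omega)
        fun i hi => hTm i (Finset.mem_of_mem_erase hi)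
      have h2 := ae_linearIndepOn_insert hn (hcard.le.trans (by omega)) (i := ⟨j, hTm _ hi⟩)
        (Finset.notMem_erase _ _) h1
      rwa [Finset.insert_erase hi] at h2
    · push Not at h0
      have hT : T = {0} := by
        obtain ⟨i, hi⟩ : T.Nonempty := Finset.card_pos.mp (by omega)
        refine Finset.eq_singleton_iff_nonempty_unique_mem.mpr ⟨⟨i, hi⟩, h0⟩
      rw [hT]
      refine Filter.Eventually.of_forall fun a => ?_
      rw [Finset.coe_singleton, linearIndepOn_singleton_iff]
      exact fun h => one_ne_zero (congrFun h 0)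

/-- The input is almost surely in general position. -/
theorem ae_generalPosition (hn : 2 ≤ n) :
    ∀ᵐ a ∂randomPoints n m, GeneralPosition (inputPoint a) m := by
  classical
  have h : ∀ᵐ a ∂randomPoints n m, ∀ T : Finset ℕ, T.card ≤ n + 1 → (∀ i ∈ T, i ≤ m) →
      LinearIndepOn ℝ (homogeneous a) (T : Set ℕ) :=
    ae_all_iff.mpr fun T => by
      by_cases hT : T.card ≤ n + 1 ∧ ∀ i ∈ T, i ≤ m
      · filter_upwards [ae_linearIndepOn hn _ T rfl hT.1 hT.2] with a ha _ _ using ha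
      · exact Filter.Eventually.of_forall fun a h1 h2 => absurd ⟨h1, h2⟩ hT
  filter_upwards [h] with a ha f hf hfm
  have h1 := ha (Finset.univ.image f)
    (by rw [Finset.card_image_of_injective _ hf, Finset.card_univ, Fintype.card_fin])
    (by simpa using hfm)
  rw [Finset.coe_image, Finset.coe_univ, Set.image_univ, linearIndepOn_range_iff hf] at h1
  exact ((Matrix.isUnit_iff_isUnit_det _).mp
    (Matrix.linearIndependent_rows_iff_isUnit.mp h1)).ne_zero

end GeneralPosition

/-! ### The number of facets -/

section Count

variable {m : ℕ}

/-- With u the unit normal, the inner product of unit vectors is 1 - dist²/2, so half-spaces cut the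
sphere in caps about u. The hypothesis only ensures that the normal is nonzero. -/
theorem exists_cap {c : Fin (n + 1) → ℝ} {x y : Fin n → ℝ} (hxy : aff c x ≠ aff c y) :
    ∃ (u : sphere (0 : EuclideanSpace ℝ (Fin n)) 1) (k : ℝ), 0 < k ∧
      ∀ z : sphere (0 : EuclideanSpace ℝ (Fin n)) 1,
        aff c (fun j => (z : EuclideanSpace ℝ (Fin n)) j) =
          aff c 0 + k * (1 - dist z u ^ 2 / 2) := by
  set v : EuclideanSpace ℝ (Fin n) := WithLp.toLp 2 fun i => c i.succ with hv
  have hv0 : v ≠ 0 := fun h => hxy <| by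
    have h0 : ∀ i : Fin n, c i.succ = 0 := fun i =>
      congrArg (fun v : EuclideanSpace ℝ (Fin n) => v i) h
    simp [aff_eq, h0]
  have hvpos : 0 < ‖v‖ := norm_pos_iff.mpr hv0
  have hmem : ‖v‖⁻¹ • v ∈ sphere (0 : EuclideanSpace ℝ (Fin n)) 1 := by
    rw [mem_sphere_zero_iff_norm, norm_smul, norm_inv, norm_norm, inv_mul_cancel₀ hvpos.ne']
  refine ⟨⟨_, hmem⟩, ‖v‖, hvpos, fun z => ?_⟩
  have h1 : aff c (fun j => (z : EuclideanSpace ℝ (Fin n)) j) =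
      aff c 0 + inner ℝ v (z : EuclideanSpace ℝ (Fin n)) := by
    rw [aff_eq, aff_eq, PiLp.inner_apply]
    simp [hv, mul_comm]
  have h2 : dist z ⟨_, hmem⟩ ^ 2 = 2 - 2 * (‖v‖⁻¹ * inner ℝ v (z : EuclideanSpace ℝ (Fin n))) := by
    rw [Subtype.dist_eq, dist_eq_norm, norm_sub_sq_real, norm_sphere, inner_smul_right,
      real_inner_comm, mem_sphere_zero_iff_norm.mp hmem]
    ring
  rw [h1, h2]
  field_simp
  ring

theorem inputPoint_succ (a : Fin m → sphere (0 : EuclideanSpace ℝ (Fin n)) 1) (j : Fin m) :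
    inputPoint a ((j : ℕ) + 1) = fun i => (a j : EuclideanSpace ℝ (Fin n)) i := by
  simp [inputPoint]

/-- If every cap of the net contains one of the points, then a facet does not contain the origin
and its vertices lie in one cap. -/
theorem IsFacet.exists_cap {a : Fin m → sphere (0 : EuclideanSpace ℝ (Fin n)) 1} {t : ℕ}
    {F : Facet n ℝ} (hn : 2 ≤ n) (htm : t ≤ m) (hF : IsFacet (inputPoint a) m t F) {ρ : ℝ}
    (hρ1 : 3 * ρ ≤ 1) {Z : Finset (sphere (0 : EuclideanSpace ℝ (Fin n)) 1)}
    (hZ : ∀ x, ∃ z ∈ Z, dist x z < ρ)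
    (hit : ∀ z ∈ Z, ∃ j : Fin m, (j : ℕ) + 1 < t ∧ a j ∈ ball z ρ) :
    ∃ z ∈ Z, ∀ i ∈ labels F.verts, ∃ j : Fin m, i = j + 1 ∧ a j ∈ ball z (3 * ρ) := by
  have hnd := hF.nodup
  have hlen := hF.length_eq
  have hm : m ∉ labels F.verts := fun h => by have := hF.lt m h; omega
  have hnonzero : ∃ i ∈ labels F.verts, i ≠ 0 := by
    by_contra! h
    have h2 := (hnd.subperm (l₂ := [0]) fun i hi => by simp [h i hi]).length_le
    rw [hlen, List.length_singleton] at h2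
    omega
  obtain ⟨i, hi, hi0⟩ := hnonzero
  have hsucc : ∀ i ∈ labels F.verts, i ≠ 0 → ∃ j : Fin m, i = j + 1 := fun i hi hi0 => by
    have := hF.lt i hi
    exact ⟨⟨i - 1, by omega⟩, by simp only; omega⟩
  -- The label m is not a vertex of F, since the labels of F are below t ≤ m; general position then
  -- makes the affine function nonconstant.
  obtain ⟨u, k, hk, hu⟩ := BeneathBeyond.exists_cap (c := F.coef) (x := inputPoint a i)
    (y := inputPoint a m) (by
      rw [hF.eq_zero i hi]
      exact (hF.ne_zero m le_rfl hm).symm)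
  have hpt : ∀ j : Fin m, aff F.coef (inputPoint a (j + 1)) =
      aff F.coef 0 + k * (1 - dist (a j) u ^ 2 / 2) := fun j => by
    rw [inputPoint_succ, hu]
  obtain ⟨z, hzZ, hz⟩ := hZ u
  obtain ⟨p, hpt', hp⟩ := hit z hzZ
  have hpu : dist (a p) u < 2 * ρ := by
    have := dist_triangle_right (a p) u z
    rw [mem_ball] at hp
    linarith
  have hpneg := hF.nonpos _ hpt'
  rw [hpt] at hpneg
  have hp0 : 0 ≤ dist (a p) u := dist_nonneg
  -- The point p is within 2ρ < 1 of u and satisfies the inequality, so the value at the origin is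
  -- strictly negative. Hence no vertex is the origin, and each vertex, having value 0, is at least
  -- as close to u as p.
  have hneg0 : aff F.coef 0 < 0 := by
    have h1 : dist (a p) u ^ 2 < 1 := by nlinarith
    nlinarith [mul_pos hk (show (0 : ℝ) < 1 - dist (a p) u ^ 2 / 2 by linarith)]
  refine ⟨z, hzZ, fun i hi => ?_⟩
  have hi0 : i ≠ 0 := by
    rintro rfl
    exact hneg0.ne (hF.eq_zero 0 hi)
  obtain ⟨j, rfl⟩ := hsucc i hi hi0
  refine ⟨j, rfl, ?_⟩
  have hj := hF.eq_zero _ hi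
  rw [hpt] at hj
  have h1 : dist (a j) u ≤ dist (a p) u := by
    have h2 : k * dist (a j) u ^ 2 ≤ k * dist (a p) u ^ 2 := by linarith
    exact (sq_le_sq₀ dist_nonneg dist_nonneg).mp (le_of_mul_le_mul_left h2 hk)
  have := dist_triangle (a j) u z
  rw [mem_ball]
  linarith

theorem IsFacet.toFinset_mem {pt : ℕ → Fin n → ℝ} {t : ℕ} {F : Facet n ℝ}
    (hF : IsFacet pt m t F) :
    (labels F.verts).toFinset ∈ Finset.powersetCard n (Finset.range t) := by
  rw [Finset.mem_powersetCard, List.toFinset_card_of_nodup hF.nodup, hF.length_eq]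
  exact ⟨fun i hi => Finset.mem_range.mpr (hF.lt i (List.mem_toFinset.mp hi)), rfl⟩

/-- A list of different facets is not longer than a set containing their label sets. -/
theorem Invariant.length_le_card {pt : ℕ → Fin n → ℝ} {t : ℕ} {Fs : List (Facet n ℝ)}
    (h : Invariant pt m t Fs) {X : Finset (Finset ℕ)}
    (hX : ∀ F ∈ Fs, (labels F.verts).toFinset ∈ X) : Fs.length ≤ X.card := by
  have h1 : (Fs.map fun F => (labels F.verts).toFinset).Nodup := by
    refine (List.nodup_map_iff_inj_on h.nodup.of_map).mpr fun F hF G hG e => ?_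
    have hF' := h.isFacet F hF
    have hG' := h.isFacet G hG
    have hperm := List.perm_of_nodup_nodup_toFinset_eq hF'.nodup hG'.nodup e
    exact List.inj_on_of_nodup_map h.nodup hF hG (hperm.eq_of_pairwise
      (fun a b _ _ h1 h2 => absurd h1 (lt_asymm h2)) hF'.pairwise hG'.pairwise)
  rw [← List.length_map (fun F : Facet n ℝ => (labels F.verts).toFinset),
    ← List.toFinset_card_of_nodup h1]
  refine Finset.card_le_card fun I hI => ?_
  obtain ⟨F, hF, rfl⟩ := List.mem_map.mp (List.mem_toFinset.mp hI)
  exact hX F hF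

theorem Invariant.length_le_pow {pt : ℕ → Fin n → ℝ} {t : ℕ} {Fs : List (Facet n ℝ)}
    (h : Invariant pt m t Fs) : Fs.length ≤ t ^ n := by
  refine (h.length_le_card fun F hF => (h.isFacet F hF).toFinset_mem).trans ?_
  rw [Finset.card_powersetCard, Finset.card_range]
  exact Nat.choose_le_pow t n

/-- The indices of the points that precede the point with label `t`. -/
def before (m t : ℕ) : Finset (Fin m) := Finset.univ.filter fun j => (j : ℕ) + 1 < t

theorem card_before {t : ℕ} (ht : t ≤ m) : (before m t).card = t - 1 := by
  have : (before m t).map Fin.valEmbedding = Finset.range (t - 1) := by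
    ext i
    simp only [before, Finset.mem_map, Finset.mem_filter, Finset.mem_univ, true_and,
      Fin.valEmbedding_apply, Finset.mem_range]
    constructor
    · rintro ⟨j, hj, rfl⟩
      omega
    · intro hi
      exact ⟨⟨i, by omega⟩, by simp only; omega, rfl⟩
  rw [← Finset.card_map, this, Finset.card_range]

open Classical in
/-- An upper bound for the number of facets: the `n`-sets of points in caps of radius `3 * ρ`, and
a trivial bound if a cap of radius `ρ` contains no point. -/
noncomputable def facetBound (t : ℕ) (ρ : ℝ)
    (Z : Finset (sphere (0 : EuclideanSpace ℝ (Fin n)) 1))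
    (a : Fin m → sphere (0 : EuclideanSpace ℝ (Fin n)) 1) : ℕ :=
  ∑ z ∈ Z, ((Finset.powersetCard n (before m t)).filter
    fun I => ∀ j ∈ I, a j ∈ ball z (3 * ρ)).card +
  t ^ n * (Z.filter fun z => ∀ j ∈ before m t, a j ∈ (ball z ρ)ᶜ).card

theorem Invariant.length_le_facetBound
    {a : Fin m → sphere (0 : EuclideanSpace ℝ (Fin n)) 1} {t : ℕ} {Fs : List (Facet n ℝ)}
    (hn : 2 ≤ n) (htm : t ≤ m) (h : Invariant (inputPoint a) m t Fs) {ρ : ℝ} (hρ : 3 * ρ ≤ 1)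
    {Z : Finset (sphere (0 : EuclideanSpace ℝ (Fin n)) 1)} (hZ : ∀ x, ∃ z ∈ Z, dist x z < ρ) :
    Fs.length ≤ facetBound t ρ Z a := by
  classical
  by_cases hit : ∀ z ∈ Z, ∃ j : Fin m, (j : ℕ) + 1 < t ∧ a j ∈ ball z ρ
  · refine (h.length_le_card (X := (Z.biUnion fun z => (Finset.powersetCard n (before m t)).filter
      fun I => ∀ j ∈ I, a j ∈ ball z (3 * ρ)).image fun I => I.image fun j : Fin m => (j : ℕ) + 1)
      fun F hF => ?_).trans
      (Finset.card_image_le.trans (Finset.card_biUnion_le.trans ?_))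
    · have hf := h.isFacet F hF
      obtain ⟨z, hz, hzF⟩ := hf.exists_cap hn htm hρ hZ hit
      have hinj : Function.Injective fun j : Fin m => (j : ℕ) + 1 := fun i j hij =>
        Fin.ext (Nat.succ_injective hij)
      have himage : (Finset.univ.filter fun j : Fin m => (j : ℕ) + 1 ∈ labels F.verts).image
          (fun j : Fin m => (j : ℕ) + 1) = (labels F.verts).toFinset := by
        ext i
        simp only [Finset.mem_image, Finset.mem_filter, Finset.mem_univ, true_and,
          List.mem_toFinset]
        constructor
        · rintro ⟨j, hj, rfl⟩
          exact hj
        · intro hi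
          obtain ⟨j, rfl, -⟩ := hzF i hi
          exact ⟨j, hi, rfl⟩
      refine Finset.mem_image.mpr ⟨_, Finset.mem_biUnion.mpr ⟨z, hz, Finset.mem_filter.mpr
        ⟨Finset.mem_powersetCard.mpr ⟨fun j hj => ?_, ?_⟩, fun j hj => ?_⟩⟩, himage⟩
      · exact Finset.mem_filter.mpr ⟨Finset.mem_univ _, hf.lt _ (Finset.mem_filter.mp hj).2⟩
      · rw [← Finset.card_image_of_injective _ hinj, himage,
          List.toFinset_card_of_nodup hf.nodup, hf.length_eq]
      · obtain ⟨j', e, hj'⟩ := hzF _ (Finset.mem_filter.mp hj).2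
        rwa [← hinj e] at hj'
    · exact Nat.le_add_right _ _
  · push Not at hit
    obtain ⟨z, hz, hzj⟩ := hit
    have : 0 < (Z.filter fun z => ∀ j ∈ before m t, a j ∈ (ball z ρ)ᶜ).card :=
      Finset.card_pos.mpr ⟨z, Finset.mem_filter.mpr
        ⟨hz, fun j hj => hzj j (Finset.mem_filter.mp hj).2⟩⟩
    calc Fs.length ≤ t ^ n := h.length_le_pow
      _ ≤ t ^ n * (Z.filter fun z => ∀ j ∈ before m t, a j ∈ (ball z ρ)ᶜ).card :=
        Nat.le_mul_of_pos_right _ this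
      _ ≤ _ := Nat.le_add_left _ _

/-! ### Its expectation -/

theorem randomPoints_forall_mem (hn : n ≠ 0) (J : Finset (Fin m))
    (B : Set (sphere (0 : EuclideanSpace ℝ (Fin n)) 1)) :
    randomPoints n m {a | ∀ j ∈ J, a j ∈ B} = sphereUniform n B ^ J.card := by
  classical
  have := isProbabilityMeasure_sphereUniform hn
  have h : {a : Fin m → sphere (0 : EuclideanSpace ℝ (Fin n)) 1 | ∀ j ∈ J, a j ∈ B} =
      Set.univ.pi fun j => if j ∈ J then B else Set.univ := by
    ext a
    simp only [Set.mem_ofPred_eq, Set.mem_pi, Set.mem_univ, true_imp_iff]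
    refine forall_congr' fun j => ?_
    by_cases hj : j ∈ J <;> simp [hj]
  rw [h, randomPoints, Measure.pi_pi, ← Finset.prod_const, ← Finset.prod_filter_mul_prod_filter_not
    Finset.univ (· ∈ J), Finset.filter_univ_mem]
  rw [Finset.prod_congr rfl fun j hj => by rw [if_pos hj]]
  refine (congrArg _ (Finset.prod_eq_one fun j hj => ?_)).trans (mul_one _)
  rw [if_neg (Finset.mem_filter.mp hj).2, measure_univ]

theorem measurableSet_forall_mem (J : Finset (Fin m))
    {B : Set (sphere (0 : EuclideanSpace ℝ (Fin n)) 1)} (hB : MeasurableSet B) :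
    MeasurableSet {a : Fin m → sphere (0 : EuclideanSpace ℝ (Fin n)) 1 | ∀ j ∈ J, a j ∈ B} :=
  MeasurableSet.pi (s := (J : Set (Fin m))) (t := fun _ => B) J.countable_toSet fun _ _ => hB

theorem cast_card_filter {α β : Type} (X : Finset α) (p : α → β → Prop) [∀ b, DecidablePred (p · b)]
    (b : β) : (((X.filter (p · b)).card : ℕ) : ℝ≥0∞) =
      ∑ x ∈ X, Set.indicator {b | p x b} (fun _ => (1 : ℝ≥0∞)) b := by
  classical
  rw [Finset.card_filter, Nat.cast_sum]
  exact Finset.sum_congr rfl fun x _ => by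
    by_cases h : p x b <;> simp [Set.indicator, h]

theorem facetBound_eq (t : ℕ) (ρ : ℝ) (Z : Finset (sphere (0 : EuclideanSpace ℝ (Fin n)) 1))
    (a : Fin m → sphere (0 : EuclideanSpace ℝ (Fin n)) 1) :
    (facetBound t ρ Z a : ℝ≥0∞) =
      ∑ z ∈ Z, ∑ I ∈ Finset.powersetCard n (before m t),
        Set.indicator {a | ∀ j ∈ I, a j ∈ ball z (3 * ρ)} (fun _ => (1 : ℝ≥0∞)) a +
      (t : ℝ≥0∞) ^ n * ∑ z ∈ Z,
        Set.indicator {a | ∀ j ∈ before m t, a j ∈ (ball z ρ)ᶜ} (fun _ => (1 : ℝ≥0∞)) a := by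
  classical
  rw [facetBound, Nat.cast_add, Nat.cast_sum, Nat.cast_mul, Nat.cast_pow]
  congr 1
  · refine Finset.sum_congr rfl fun z _ => ?_
    exact cast_card_filter _ (fun (I : Finset (Fin m))
      (a : Fin m → sphere (0 : EuclideanSpace ℝ (Fin n)) 1) => ∀ j ∈ I, a j ∈ ball z (3 * ρ)) a
  · congr 1
    exact cast_card_filter _ (fun z (a : Fin m → sphere (0 : EuclideanSpace ℝ (Fin n)) 1) =>
      ∀ j ∈ before m t, a j ∈ (ball z ρ)ᶜ) a

theorem measurable_facetBound (t : ℕ) (ρ : ℝ)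
    (Z : Finset (sphere (0 : EuclideanSpace ℝ (Fin n)) 1)) :
    Measurable fun a : Fin m → sphere (0 : EuclideanSpace ℝ (Fin n)) 1 =>
      (facetBound t ρ Z a : ℝ≥0∞) := by
  simp only [facetBound_eq]
  refine (Finset.measurable_fun_sum _ fun z _ => Finset.measurable_fun_sum _ fun I _ =>
    measurable_const.indicator (measurableSet_forall_mem I measurableSet_ball)).add
    (Measurable.const_mul (Finset.measurable_fun_sum _ fun z _ =>
    measurable_const.indicator (measurableSet_forall_mem _ measurableSet_ball.compl)) _)

/-- By linearity and independence: a given n-set falls into a ball of radius 3ρ with probability at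
most q^n, and all t - 1 earlier points miss a cap of radius ρ with probability at most (1 -
p)^(t-1). -/
theorem lintegral_facetBound_le (hn : n ≠ 0) {t : ℕ} (htm : t ≤ m) (ρ : ℝ)
    (Z : Finset (sphere (0 : EuclideanSpace ℝ (Fin n)) 1)) {p q : ℝ}
    (hq : ∀ z ∈ Z, (sphereUniform n).real (ball z (3 * ρ)) ≤ q)
    (hp : ∀ z ∈ Z, p ≤ (sphereUniform n).real (ball z ρ)) :
    ∫⁻ a, (facetBound t ρ Z a : ℝ≥0∞) ∂randomPoints n m ≤
      ENNReal.ofReal (Z.card * (t ^ n * q ^ n) + t ^ n * (Z.card * (1 - p) ^ (t - 1))) := by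
  have := isProbabilityMeasure_sphereUniform hn
  rcases Z.eq_empty_or_nonempty with rfl | ⟨z0, hz0⟩
  · simp [facetBound]
  have hq0 : 0 ≤ q := measureReal_nonneg.trans (hq z0 hz0)
  have hp1 : 0 ≤ 1 - p := sub_nonneg.mpr ((hp z0 hz0).trans measureReal_le_one)
  have e : ∀ (J : Finset (Fin m)) (B : Set (sphere (0 : EuclideanSpace ℝ (Fin n)) 1)),
      MeasurableSet B → ∫⁻ a, Set.indicator
        {a : Fin m → sphere (0 : EuclideanSpace ℝ (Fin n)) 1 | ∀ j ∈ J, a j ∈ B}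
        (fun _ => (1 : ℝ≥0∞)) a ∂randomPoints n m = sphereUniform n B ^ J.card := fun J B hB => by
    rw [lintegral_indicator_const (measurableSet_forall_mem J hB), one_mul,
      randomPoints_forall_mem hn]
  have mi : ∀ (J : Finset (Fin m)) (B : Set (sphere (0 : EuclideanSpace ℝ (Fin n)) 1)),
      MeasurableSet B → Measurable
        (Set.indicator {a : Fin m → sphere (0 : EuclideanSpace ℝ (Fin n)) 1 | ∀ j ∈ J, a j ∈ B} (fun _ => (1 : ℝ≥0∞))) := fun J B hB =>
    measurable_const.indicator (measurableSet_forall_mem J hB)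
  simp only [facetBound_eq]
  rw [lintegral_add_left (Finset.measurable_fun_sum _ fun z _ => Finset.measurable_fun_sum _
    fun I _ => mi I _ measurableSet_ball), lintegral_finsetSum _ (fun z _ =>
    Finset.measurable_fun_sum _ fun I _ => mi I _ measurableSet_ball), lintegral_const_mul _
    (Finset.measurable_fun_sum _ fun z _ => mi _ _ measurableSet_ball.compl),
    lintegral_finsetSum _ (fun z _ => mi _ _ measurableSet_ball.compl),
    ENNReal.ofReal_add (by positivity) (by positivity)]
  refine add_le_add ?_ ?_
  · rw [ENNReal.ofReal_mul (by positivity), ENNReal.ofReal_natCast, ← nsmul_eq_mul]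
    refine Finset.sum_le_card_nsmul _ _ _ fun z hz => ?_
    rw [lintegral_finsetSum _ fun I _ => mi I _ measurableSet_ball]
    have h1 : sphereUniform n (ball z (3 * ρ)) ≤ ENNReal.ofReal q := by
      rw [← ENNReal.ofReal_toReal (measure_ne_top (sphereUniform n) (ball z (3 * ρ)))]
      exact ENNReal.ofReal_le_ofReal (hq z hz)
    have h2 : (Finset.powersetCard n (before m t)).card ≤ t ^ n := by
      rw [Finset.card_powersetCard, card_before htm]
      exact (Nat.choose_le_pow _ _).trans (Nat.pow_le_pow_left (Nat.sub_le t 1) n)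
    refine (Finset.sum_le_card_nsmul _ _ (ENNReal.ofReal q ^ n) fun I hI => ?_).trans ?_
    · rw [e I _ measurableSet_ball, (Finset.mem_powersetCard.mp hI).2]
      gcongr
    · rw [nsmul_eq_mul, ENNReal.ofReal_mul (by positivity), ENNReal.ofReal_pow hq0]
      gcongr
      rw [← Nat.cast_pow, ENNReal.ofReal_natCast]
      exact_mod_cast h2
  · rw [ENNReal.ofReal_mul (by positivity), ENNReal.ofReal_mul (by positivity),
      ENNReal.ofReal_natCast, ← nsmul_eq_mul, ← Nat.cast_pow, ← Nat.cast_pow,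
      ENNReal.ofReal_natCast]
    refine mul_le_mul_right (Finset.sum_le_card_nsmul _ _ _ fun z hz => ?_) _
    rw [e _ _ measurableSet_ball.compl, card_before htm, ENNReal.ofReal_pow hp1]
    gcongr
    rw [← ENNReal.ofReal_toReal (measure_ne_top (sphereUniform n) (ball z ρ)ᶜ),
      ← measureReal_def, probReal_compl_eq_one_sub measurableSet_ball]
    exact ENNReal.ofReal_le_ofReal (by linarith [hp z hz])

end Count

/-! ### Choice of the cap radius and the expected number of facets. -/

section Expectation


theorem half_le_log {m : ℕ} (hm : 2 ≤ m) : 1 / 2 ≤ Real.log m := by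
  have h1 := Real.log_two_gt_d9
  have h2 : Real.log 2 ≤ Real.log m := Real.log_le_log two_pos (by exact_mod_cast hm)
  linarith

theorem lintegral_facetBound_le_of_pow_eq (hn : 2 ≤ n) {c K ℓ ρ s : ℝ} {m t : ℕ}
    (hc : c = 2 / (16 ^ n * n)) (hK : K = (n + 1) / c) (hm : 2 ≤ m) (hℓ : ℓ = Real.log m)
    (ht : 2 ≤ t) (htm : t ≤ m) (hs : s = t - 1) (hρ0 : 0 < ρ) (hρ1 : 3 * ρ ≤ 1)
    (hρ : ρ ^ (n - 1) = K * ℓ / s) {Z : Finset (sphere (0 : EuclideanSpace ℝ (Fin n)) 1)}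
    (hZ : (Z.card : ℝ) * (c * (ρ / 2) ^ (n - 1)) ≤ 1) :
    ∫⁻ a, (facetBound t ρ Z a : ℝ≥0∞) ∂randomPoints n m ≤
      ENNReal.ofReal ((2 ^ (n - 1) / c * (2 ^ (n + 1) * 3 ^ (n - 1)) ^ n * (2 * K) ^ (n - 1) * 2 +
        2 ^ n * 2 ^ n) * (m * ℓ ^ n)) := by
  have hn1 : n - 1 + 1 = n := by omega
  have hnpos : (0 : ℝ) < n := by exact_mod_cast (show 0 < n by omega)
  have hcpos : 0 < c := by rw [hc]; positivity
  have hKpos : 0 < K := by rw [hK]; positivity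
  have hmR : (2 : ℝ) ≤ m := by exact_mod_cast hm
  have htR : (2 : ℝ) ≤ t := by exact_mod_cast ht
  have htmR : (t : ℝ) ≤ m := by exact_mod_cast htm
  have hℓ2 : 1 / 2 ≤ ℓ := hℓ ▸ half_le_log hm
  have hspos : 0 < s := by linarith
  set Q := ρ ^ (n - 1) with hQ
  have hQpos : 0 < Q := by positivity
  have hQ1 : Q ≤ 1 := pow_le_one₀ hρ0.le (by linarith)
  have hZ' : (Z.card : ℝ) ≤ 2 ^ (n - 1) / (c * Q) := by
    rw [div_pow, ← hQ] at hZ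
    rw [le_div_iff₀ (by positivity)]
    have h2 : (0 : ℝ) < 2 ^ (n - 1) := by positivity
    calc (Z.card : ℝ) * (c * Q) = Z.card * (c * (Q / 2 ^ (n - 1))) * 2 ^ (n - 1) := by
          field_simp
      _ ≤ 1 * 2 ^ (n - 1) := mul_le_mul_of_nonneg_right hZ h2.le
      _ = 2 ^ (n - 1) := one_mul _
  have hc1 : c ≤ 1 := by
    rw [hc, div_le_one (by positivity)]
    have h1 : (1 : ℝ) ≤ 16 ^ n := one_le_pow₀ (by norm_num)
    have h2 : (2 : ℝ) ≤ n := by exact_mod_cast hn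
    nlinarith
  refine (lintegral_facetBound_le (by omega) htm ρ Z (p := c * Q) (q := 2 ^ (n + 1) *
    (3 * ρ) ^ (n - 1)) (fun z _ => (sphereUniform_real_ball (by omega) z (by linarith) hρ1).2)
    fun z _ => ?_).trans (ENNReal.ofReal_le_ofReal ?_)
  · rw [hc]
    exact (sphereUniform_real_ball (by omega) z hρ0 (by linarith)).1
  rw [add_mul]
  have hpow : ℓ ^ (n - 1) ≤ 2 * ℓ ^ n := by
    have h1 : 0 ≤ ℓ ^ (n - 1) := by positivity
    have h2 : ℓ ^ n = ℓ ^ (n - 1) * ℓ := by rw [← pow_succ, hn1]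
    nlinarith
  refine add_le_add ?_ ?_
  -- The term of the n-sets: |Z| is of order 1/Q, each cap has measure of order Q, and tQ is of
  -- order ℓ because t ≤ 2s. One of the n factors Q cancels the size of the net.
  · have h1 : (t : ℝ) * Q ≤ 2 * K * ℓ := by
      rw [hρ, mul_div_assoc', div_le_iff₀ hspos]
      have : 0 ≤ K * ℓ := by positivity
      nlinarith
    have h2 : (t : ℝ) ^ n * Q ^ n = t * (t * Q) ^ (n - 1) * Q := by
      rw [mul_pow, ← hn1, pow_succ, pow_succ, hn1]
      ring
    have h3 : ((t : ℝ) * Q) ^ (n - 1) ≤ (2 * K) ^ (n - 1) * (2 * ℓ ^ n) := by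
      calc ((t : ℝ) * Q) ^ (n - 1) ≤ (2 * K * ℓ) ^ (n - 1) :=
            pow_le_pow_left₀ (by positivity) h1 _
        _ = (2 * K) ^ (n - 1) * ℓ ^ (n - 1) := mul_pow _ _ _
        _ ≤ _ := mul_le_mul_of_nonneg_left hpow (by positivity)
    calc (Z.card : ℝ) * (t ^ n * (2 ^ (n + 1) * (3 * ρ) ^ (n - 1)) ^ n)
        = Z.card * ((2 ^ (n + 1) * 3 ^ (n - 1)) ^ n * (t ^ n * Q ^ n)) := by
          rw [mul_pow 3 ρ, ← hQ, ← mul_assoc (2 ^ (n + 1)), mul_pow _ Q]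
          ring
      _ ≤ 2 ^ (n - 1) / (c * Q) * ((2 ^ (n + 1) * 3 ^ (n - 1)) ^ n * (t ^ n * Q ^ n)) :=
          mul_le_mul_of_nonneg_right hZ' (by positivity)
      _ = 2 ^ (n - 1) / c * (2 ^ (n + 1) * 3 ^ (n - 1)) ^ n * (t * (t * Q) ^ (n - 1)) := by
          rw [h2]
          field_simp
      _ ≤ 2 ^ (n - 1) / c * (2 ^ (n + 1) * 3 ^ (n - 1)) ^ n *
          (m * ((2 * K) ^ (n - 1) * (2 * ℓ ^ n))) := by
          gcongr
      _ = _ := by ring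
  -- The value of K makes c Q s equal to (n + 1) log m. The power m^(n+1) pays for the trivial bound
  -- t^n and for the at most 2^n m caps.
  · have h1 : (1 - c * Q) ^ (t - 1) ≤ 1 / (m : ℝ) ^ (n + 1) := by
      have h2 : 1 - c * Q ≤ Real.exp (-(c * Q)) := by
        have := Real.add_one_le_exp (-(c * Q))
        linarith
      calc (1 - c * Q) ^ (t - 1) ≤ Real.exp (-(c * Q)) ^ (t - 1) :=
            pow_le_pow_left₀ (by nlinarith) h2 _
        _ = Real.exp (-((n + 1 : ℕ) * Real.log m)) := by
            rw [← Real.exp_nat_mul]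
            congr 1
            rw [Nat.cast_sub (by omega), Nat.cast_one, ← hs, hρ, hK, ← hℓ]
            push_cast
            field_simp
        _ = 1 / (m : ℝ) ^ (n + 1) := by
            rw [Real.exp_neg, Real.exp_nat_mul, Real.exp_log (by linarith), one_div]
    have h3 : (Z.card : ℝ) ≤ 2 ^ n * m := by
      refine hZ'.trans ?_
      rw [hρ, hK]
      have e : c * ((n + 1) / c * ℓ / s) = (n + 1) * ℓ / s := by field_simp
      rw [e, div_div_eq_mul_div, div_le_iff₀ (by positivity)]
      have h4 : (2 : ℝ) ^ n = 2 ^ (n - 1) * 2 := by rw [← pow_succ, hn1]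
      rw [h4]
      have h5 : s ≤ 2 * m * ((n + 1) * ℓ) := by
        have : (1 : ℝ) ≤ 2 * ((n + 1) * ℓ) := by nlinarith
        nlinarith
      calc (2 : ℝ) ^ (n - 1) * s ≤ 2 ^ (n - 1) * (2 * m * ((n + 1) * ℓ)) := by gcongr
        _ = _ := by ring
    have h6 : (1 : ℝ) ≤ 2 ^ n * ℓ ^ n := by
      rw [← mul_pow]
      exact one_le_pow₀ (by linarith)
    have hmpos : (0 : ℝ) < m := by linarith
    calc (t : ℝ) ^ n * (Z.card * (1 - c * Q) ^ (t - 1))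
        ≤ m ^ n * (2 ^ n * m * (1 / (m : ℝ) ^ (n + 1))) := by
          have : 0 ≤ 1 - c * Q := by nlinarith
          gcongr
      _ = 2 ^ n := by
          rw [pow_succ]
          field_simp
      _ ≤ 2 ^ n * ((2 ^ n * ℓ ^ n) * m) := by
          refine le_mul_of_one_le_right (by positivity) ?_
          nlinarith
      _ = _ := by ring

/-- The expected number of facets is at most linear, up to logarithmic factors. -/
theorem exists_expected_length_le (hn : 2 ≤ n) : ∃ b : ℝ, 0 ≤ b ∧ ∀ m t : ℕ, 2 ≤ m → t ≤ m →
    ∃ N : (Fin m → sphere (0 : EuclideanSpace ℝ (Fin n)) 1) → ℕ,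
      (Measurable fun a => (N a : ℝ≥0∞)) ∧
      (∀ a Fs, Invariant (inputPoint a) m t Fs → Fs.length ≤ N a) ∧
      ∫⁻ a, (N a : ℝ≥0∞) ∂randomPoints n m ≤ ENNReal.ofReal (b * (m * Real.log m ^ n)) := by
  have hP := isProbabilityMeasure_sphereUniform (n := n) (by omega)
  have hnpos : (0 : ℝ) < n := by exact_mod_cast (show 0 < n by omega)
  obtain ⟨c, hc⟩ : ∃ c : ℝ, c = 2 / (16 ^ n * n) := ⟨_, rfl⟩
  have hcpos : 0 < c := by rw [hc]; positivity
  obtain ⟨K, hK⟩ : ∃ K : ℝ, K = (n + 1) / c := ⟨_, rfl⟩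
  have hKpos : 0 < K := by rw [hK]; positivity
  -- The threshold is such that t > κℓ implies t ≥ 2 and 3^(n-1) K ℓ ≤ t - 1, the latter being the
  -- condition 3ρ ≤ 1. Below it t^n is already polylogarithmic.
  set κ : ℝ := 2 + 2 * (3 ^ (n - 1) * K) with hκ
  set b₁ : ℝ := 2 ^ (n - 1) / c * (2 ^ (n + 1) * 3 ^ (n - 1)) ^ n * (2 * K) ^ (n - 1) * 2 +
    2 ^ n * 2 ^ n with hb₁
  have hb₁0 : 0 ≤ b₁ := by positivity
  refine ⟨κ ^ n + b₁, by positivity, fun m t hm htm => ?_⟩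
  have hℓ2 := half_le_log hm
  set ℓ := Real.log m with hℓ
  have hm1 : (2 : ℝ) ≤ m := by exact_mod_cast hm
  by_cases hcase : (t : ℝ) ≤ κ * ℓ
  · refine ⟨fun _ => t ^ n, measurable_const, fun a Fs h => h.length_le_pow, ?_⟩
    have hprob : IsProbabilityMeasure (randomPoints n m) := by
      unfold randomPoints
      infer_instance
    rw [lintegral_const, measure_univ, mul_one, ← ENNReal.ofReal_natCast]
    refine ENNReal.ofReal_le_ofReal ?_
    push_cast
    have h1 : (t : ℝ) ^ n ≤ κ ^ n * ℓ ^ n := by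
      rw [← mul_pow]
      exact pow_le_pow_left₀ (by positivity) hcase n
    have h2 : 0 ≤ ℓ ^ n := by positivity
    calc (t : ℝ) ^ n ≤ κ ^ n * ℓ ^ n := h1
      _ ≤ κ ^ n * (m * ℓ ^ n) := by
          refine mul_le_mul_of_nonneg_left ?_ (by positivity)
          nlinarith
      _ ≤ (κ ^ n + b₁) * (m * ℓ ^ n) := by
          refine mul_le_mul_of_nonneg_right ?_ (by positivity)
          linarith
  · push Not at hcase
    have h3K : 0 < 3 ^ (n - 1) * K := by positivity
    have ht : 2 ≤ t := by
      have : (1 : ℝ) < t := by nlinarith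
      exact_mod_cast this
    have htR : (2 : ℝ) ≤ t := by exact_mod_cast ht
    obtain ⟨s, hs⟩ : ∃ s : ℝ, s = t - 1 := ⟨_, rfl⟩
    have hspos : 0 < s := by linarith
    have hsl : 3 ^ (n - 1) * K * ℓ ≤ s := by nlinarith
    obtain ⟨ρ, hρ0, hρ⟩ : ∃ ρ : ℝ, 0 < ρ ∧ ρ ^ (n - 1) = K * ℓ / s :=
      ⟨(K * ℓ / s) ^ (((n - 1 : ℕ) : ℝ)⁻¹), by positivity,
        Real.rpow_inv_natCast_pow (by positivity) (by omega)⟩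
    have hρ1 : 3 * ρ ≤ 1 := by
      refine (pow_le_one_iff_of_nonneg (by positivity) (by omega : n - 1 ≠ 0)).mp ?_
      rw [mul_pow, hρ, mul_div_assoc', div_le_one hspos, ← mul_assoc]
      exact hsl
    obtain ⟨Z, hZ, hZc⟩ := exists_net (n := n) (by omega) hρ0 (by linarith)
    rw [← hc] at hZc
    refine ⟨facetBound t ρ Z, measurable_facetBound t ρ Z,
      fun a Fs h => h.length_le_facetBound hn htm hρ1 hZ,
      (lintegral_facetBound_le_of_pow_eq hn hc hK hm hℓ ht htm hs hρ0 hρ1 hρ hZc).trans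
        (ENNReal.ofReal_le_ofReal ?_)⟩
    refine mul_le_mul_of_nonneg_right ?_ (by positivity)
    have : 0 ≤ κ ^ n := by positivity
    linarith

end Expectation

end BeneathBeyond

/-! ### Summation of the expected costs over all insertions. -/

theorem mainTheorem5 (n : ℕ) (hn : 2 ≤ n) :
    ∃ (C : ℝ) (k : ℕ), ∀ m : ℕ, 2 ≤ m →
      ∫⁻ a, (BeneathBeyond.runningTime a : ℝ≥0∞) ∂(BeneathBeyond.randomPoints n m) ≤
        ENNReal.ofReal (C * (m : ℝ) ^ 2 * (Real.log (m : ℝ)) ^ k) := by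
  open BeneathBeyond in
  have hP := isProbabilityMeasure_sphereUniform (n := n) (by omega)
  obtain ⟨A, hA⟩ := exists_runningTime_le n
  obtain ⟨b, hb0, hb⟩ := exists_expected_length_le hn
  have hn0 : (0 : ℝ) ≤ n := Nat.cast_nonneg n
  refine ⟨A * 2 ^ (n + 1) + A * (b + 2 ^ n) * (7 * (n + 1)) * 2, n + 1, fun m hm => ?_⟩
  have hprob : IsProbabilityMeasure (randomPoints n m) := by
    unfold randomPoints
    infer_instance
  have hℓ2 := half_le_log hm
  have hm1 : (2 : ℝ) ≤ m := by exact_mod_cast hm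
  set ℓ := Real.log m with hℓ
  choose! N hNm hN hNint using fun t ht => hb m t hm ht
  -- A deterministic bound for the sorting depth: n |Fs| ≤ 2^n m^n ≤ 2^D.
  set D : ℕ := n * (1 + (Nat.log 2 m + 1)) with hD
  have hD1 : (D : ℝ) + 1 ≤ 7 * (n + 1) * ℓ := by
    have h1 : (Nat.log 2 m : ℝ) ≤ 2 * ℓ := by
      have h2 := Real.natLog_le_logb m 2
      have h3 : Real.logb 2 m ≤ 2 * ℓ := by
        rw [Real.logb, div_le_iff₀ (Real.log_pos one_lt_two)]
        have := Real.log_two_gt_d9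
        nlinarith
      exact h2.trans (by exact_mod_cast h3)
    rw [hD]
    push_cast
    nlinarith
  have hbound : ∀ᵐ a ∂randomPoints n m, (runningTime a : ℝ≥0∞) ≤
      A + ∑ t ∈ Finset.Icc n m, (A : ℝ≥0∞) * (((N t a : ℝ≥0∞) + 1) * ((D : ℝ≥0∞) + 1)) := by
    filter_upwards [ae_generalPosition hn] with a ha
    have := hA m D a (fun t => N t a) ha fun t Fs ht h => ⟨hN t ht a Fs h, by
      have h1 : m < 2 ^ (Nat.log 2 m + 1) := Nat.lt_pow_succ_log_self one_lt_two m
      calc n * Fs.length ≤ 2 ^ n * (2 ^ (Nat.log 2 m + 1)) ^ n :=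
            Nat.mul_le_mul Nat.lt_two_pow_self.le
              (h.length_le_pow.trans (Nat.pow_le_pow_left (ht.trans h1.le) n))
        _ = 2 ^ D := by rw [hD, ← pow_mul, ← pow_add]; ring⟩
    exact_mod_cast this
  have hterm : ∀ t ∈ Finset.Icc n m,
      ∫⁻ a, (A : ℝ≥0∞) * (((N t a : ℝ≥0∞) + 1) * ((D : ℝ≥0∞) + 1)) ∂randomPoints n m ≤
        ENNReal.ofReal (A * ((b + 2 ^ n) * (m * ℓ ^ n) * (7 * (n + 1) * ℓ))) := fun t ht => by
    have htm := (Finset.mem_Icc.mp ht).2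
    have hm' := hNm t htm
    rw [lintegral_const_mul _ ((hm'.add_const 1).mul_const _), lintegral_mul_const _
      (hm'.add_const 1), lintegral_add_right _ measurable_const, lintegral_const, measure_univ,
      mul_one, ENNReal.ofReal_mul (Nat.cast_nonneg A), ENNReal.ofReal_natCast,
      ENNReal.ofReal_mul (by positivity), add_mul b, ENNReal.ofReal_add (by positivity)
      (by positivity)]
    have h1 : (1 : ℝ≥0∞) ≤ ENNReal.ofReal (2 ^ n * (m * ℓ ^ n)) := by
      rw [ENNReal.one_le_ofReal]
      have h2 : (1 : ℝ) ≤ (2 * ℓ) ^ n := one_le_pow₀ (by linarith)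
      rw [mul_pow] at h2
      nlinarith
    have h3 : (D : ℝ≥0∞) + 1 ≤ ENNReal.ofReal (7 * (n + 1) * ℓ) := by
      refine le_trans (le_of_eq ?_) (ENNReal.ofReal_le_ofReal hD1)
      rw [ENNReal.ofReal_add (by positivity) zero_le_one, ENNReal.ofReal_natCast,
        ENNReal.ofReal_one]
    gcongr
    exact hNint t htm
  -- Passing to a measurable majorant almost everywhere, so measurability of the running time itself
  -- is not needed.
  calc ∫⁻ a, (runningTime a : ℝ≥0∞) ∂randomPoints n m
      ≤ ∫⁻ a, (A + ∑ t ∈ Finset.Icc n m,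
          (A : ℝ≥0∞) * (((N t a : ℝ≥0∞) + 1) * ((D : ℝ≥0∞) + 1))) ∂randomPoints n m :=
        lintegral_mono_ae hbound
    _ = A + ∑ t ∈ Finset.Icc n m,
          ∫⁻ a, (A : ℝ≥0∞) * (((N t a : ℝ≥0∞) + 1) * ((D : ℝ≥0∞) + 1)) ∂randomPoints n m := by
        rw [lintegral_add_left measurable_const, lintegral_const, measure_univ, mul_one,
          lintegral_finsetSum' _ fun t ht => ?_]
        exact ((((hNm t (Finset.mem_Icc.mp ht).2).add_const 1).mul_const _).const_mul
          _).aemeasurable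
    _ ≤ A + (Finset.Icc n m).card •
          ENNReal.ofReal (A * ((b + 2 ^ n) * (m * ℓ ^ n) * (7 * (n + 1) * ℓ))) := by
        gcongr
        exact Finset.sum_le_card_nsmul _ _ _ hterm
    _ = ENNReal.ofReal (A + ((Finset.Icc n m).card : ℝ) *
          (A * ((b + 2 ^ n) * (m * ℓ ^ n) * (7 * (n + 1) * ℓ)))) := by
        rw [ENNReal.ofReal_add (by positivity) (by positivity), ENNReal.ofReal_natCast,
          ENNReal.ofReal_mul (Nat.cast_nonneg (Finset.Icc n m).card), ENNReal.ofReal_natCast,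
          nsmul_eq_mul]
    _ ≤ _ := by
        refine ENNReal.ofReal_le_ofReal ?_
        have h1 : ((Finset.Icc n m).card : ℝ) ≤ 2 * m := by
          rw [Nat.card_Icc]
          have : m + 1 - n ≤ 2 * m := by omega
          exact_mod_cast this
        have h2 : (1 : ℝ) ≤ 2 ^ (n + 1) * ℓ ^ (n + 1) := by
          rw [← mul_pow]
          exact one_le_pow₀ (by linarith)
        have h3 : (1 : ℝ) ≤ 2 ^ (n + 1) * ℓ ^ (n + 1) * m ^ 2 := by nlinarith
        have hA0 : (0 : ℝ) ≤ A := Nat.cast_nonneg A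
        calc (A : ℝ) + ((Finset.Icc n m).card : ℝ) *
              (A * ((b + 2 ^ n) * (m * ℓ ^ n) * (7 * (n + 1) * ℓ)))
            ≤ A * (2 ^ (n + 1) * ℓ ^ (n + 1) * m ^ 2) + 2 * m *
              (A * ((b + 2 ^ n) * (m * ℓ ^ n) * (7 * (n + 1) * ℓ))) := by
              refine add_le_add (le_mul_of_one_le_right hA0 h3) ?_
              exact mul_le_mul_of_nonneg_right h1 (by positivity)
          _ = _ := by ring
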